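/- For any finite set $S \subset \mathbb{R}$ there exist a natural number $N$ and a real number $\delta > 0$ with the following property: for every $n > N$ and every irreducible complex character $\varphi$ of the symmetric group $\mathsf{S}_n$, there exists an irreducible complex character $\psi$ of $\mathsf{S}_n$ such that $$\frac{\psi(1)}{\varphi(1)} \in [\delta,\infty) \setminus S.$$ -/

import Mathlib

/-- `χ : G → ℂ` is an irreducible (complex) character of `G`: the character `g ↦ tr (ρ g)` of some
finite-dimensional irreducible complex representation `ρ : G → GL(V)`. (A finite-dimensional space
is isomorphic to some `Fin d → ℂ`, so letting `V` range over `Type` yields all such characters.) -/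
def IsIrreducibleCharacter {G : Type} [Group G] (χ : G → ℂ) : Prop :=
  ∃ (V : Type) (_ : AddCommGroup V) (_ : Module ℂ V) (ρ : Representation ℂ G V),
    FiniteDimensional ℂ V ∧ ρ.IsIrreducible ∧ χ = ρ.character

/-! In terms of Young diagrams, the new representation comes from moving one box. Let `ρ` be
irreducible of degree d for the symmetric group on n points. Restrict to n - 1 points, choose a
constituent, induce back, and choose a constituent there. No diagrams are used: Y is the set of
eigenvalues of the Jucys–Murphy element on `ρ` (contents of removable boxes), and X the set of its
eigenvalues on the coinduction of `ρ` to n + 1 points (contents of addable boxes). Let p x be the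
share of the x-eigenspace in the coinduced module and a y be n times the share of the y-eigenspace
in `ρ`. If |x - y| > 1, some irreducible representation of the same group has degree w(x, y) d,
where w(x, y) = a y * p x * (1 - 1/(x - y)²); this is `exists_interlacingWeights`.

The algebra rests on `condExp_resolvent`, which computes conditional expectations of resolvents of
Jucys–Murphy elements. By Schur's lemma these act as scalar rational functions of z. In particular ∑
p x / (z - x) and z - ∑ a y / (z - y) are reciprocal. Comparing residues shows that branching is
multiplicity free and that X and Y interlace at distance at least 1.

The rest is counting. The w(x, y) sum to n - |Y| (`sum_weights`) and |Y| is at most 9√n (`card_le`),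
so there are O(n) pairs and the average weight is bounded below. If every weight that is at least
1/324 lay in S, then order n pairs would have their weight in S. But two distinct y, y' share at
most 4|S|² values x with both weights positive and in S, since fixing both weights puts x among the
roots of a quartic. By Cauchy–Schwarz only O(n^{3/4}) such pairs exist, which is impossible for
large n (`exists_weight_avoiding`). -/

section

open Equiv MonoidAlgebra

/-! ### Point stabilisers, group algebras and conditional expectation. -/

/-- The embedding of the symmetric group on `α` as the stabiliser of the point `none`. -/
def permOption (α : Type*) : Perm α →* Perm (Option α) where
  toFun := optionCongr
  map_one' := optionCongr_one
  map_mul' σ τ := by ext1 x; cases x <;> simp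

theorem permOption_injective (α : Type*) : Function.Injective (permOption α) :=
  optionCongr_injective

@[simp] theorem permOption_none {α : Type*} (σ : Perm α) : permOption α σ none = none := rfl

@[simp] theorem permOption_some {α : Type*} (σ : Perm α) (a : α) :
    permOption α σ (some a) = some (σ a) := rfl

theorem mem_range_permOption {α : Type*} {τ : Perm (Option α)} :
    τ ∈ Set.range (permOption α) ↔ τ none = none := by
  classical
  constructor
  · rintro ⟨σ, rfl⟩; rfl
  · intro h
    refine ⟨removeNone τ, ?_⟩
    change (removeNone τ).optionCongr = τ
    rw [map_equiv_removeNone, h, swap_self]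
    rfl

section GroupAlgebra

variable (α : Type*) [Fintype α] [DecidableEq α]

/-- The Jucys–Murphy element: the sum of the transpositions moving the point `none`. -/
noncomputable def jucysMurphy : MonoidAlgebra ℂ (Perm (Option α)) :=
  ∑ a : α, single (swap none (some a)) 1

/-- The sum over all pairs `(a, b)` of the permutation exchanging `a` and `b`. -/
noncomputable def swapSum : MonoidAlgebra ℂ (Perm α) := ∑ a : α, ∑ b : α, single (swap a b) 1

end GroupAlgebra

section Inclusion

variable {α : Type*}

/-- The inclusion of group algebras induced by `permOption`. -/
noncomputable def groupAlgInc :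
    MonoidAlgebra ℂ (Perm α) →ₐ[ℂ] MonoidAlgebra ℂ (Perm (Option α)) :=
  mapDomainAlgHom ℂ ℂ (permOption α)

/-- The restriction of coefficients to the stabiliser of `none`. -/
noncomputable def condExp :
    MonoidAlgebra ℂ (Perm (Option α)) →+ MonoidAlgebra ℂ (Perm α) :=
  comapDomainAddMonoidHom (permOption α) (permOption_injective α)

@[simp] theorem groupAlgInc_single (σ : Perm α) (r : ℂ) :
    groupAlgInc (single σ r) = single (permOption α σ) r := by
  simp [groupAlgInc]

@[simp] theorem condExp_coeff (a : MonoidAlgebra ℂ (Perm (Option α))) (σ : Perm α) :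
    (condExp a).coeff σ = a.coeff (permOption α σ) := by
  simp [condExp]

theorem condExp_single_permOption (σ : Perm α) (r : ℂ) :
    condExp (single (permOption α σ) r) = single σ r :=
  comapDomain_single_map _ (permOption_injective α) _ _

theorem condExp_single_of_ne {τ : Perm (Option α)} (h : τ none ≠ none) (r : ℂ) :
    condExp (single τ r) = 0 :=
  comapDomain_single_of_not_mem_range (fun h' => h (mem_range_permOption.1 h'))
    (permOption_injective α)

theorem condExp_one : condExp (1 : MonoidAlgebra ℂ (Perm (Option α))) = 1 := by
  have := condExp_single_permOption (1 : Perm α) (1 : ℂ)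
  rwa [map_one] at this

theorem condExp_groupAlgInc_mul (a : MonoidAlgebra ℂ (Perm α))
    (b : MonoidAlgebra ℂ (Perm (Option α))) : condExp (groupAlgInc a * b) = a * condExp b := by
  induction a using MonoidAlgebra.induction_linear with
  | zero => simp
  | add x y hx hy => simp only [map_add, add_mul, hx, hy]
  | single σ r =>
    induction b using MonoidAlgebra.induction_linear with
    | zero => simp
    | add x y hx hy => simp only [map_add, mul_add, hx, hy]
    | single τ t =>
      rw [groupAlgInc_single, single_mul_single]
      by_cases h : τ none = none
      · obtain ⟨τ, rfl⟩ := mem_range_permOption.2 h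
        rw [← map_mul, condExp_single_permOption, condExp_single_permOption, single_mul_single]
      · rw [condExp_single_of_ne h, condExp_single_of_ne, mul_zero]
        intro h'
        apply h
        have : permOption α σ (τ none) = permOption α σ none := h'
        exact (permOption α σ).injective this

theorem condExp_mul_groupAlgInc (a : MonoidAlgebra ℂ (Perm α))
    (b : MonoidAlgebra ℂ (Perm (Option α))) : condExp (b * groupAlgInc a) = condExp b * a := by
  induction a using MonoidAlgebra.induction_linear with
  | zero => simp
  | add x y hx hy => simp only [map_add, mul_add, hx, hy]
  | single σ r =>
    induction b using MonoidAlgebra.induction_linear with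
    | zero => simp
    | add x y hx hy => simp only [map_add, add_mul, hx, hy]
    | single τ t =>
      rw [groupAlgInc_single, single_mul_single]
      by_cases h : τ none = none
      · obtain ⟨τ, rfl⟩ := mem_range_permOption.2 h
        rw [← map_mul, condExp_single_permOption, condExp_single_permOption, single_mul_single]
      · rw [condExp_single_of_ne h, condExp_single_of_ne, zero_mul]
        exact h

end Inclusion

/-! ### Relations between consecutive Jucys–Murphy elements and their resolvents. -/

section Relations

variable {α : Type*} [DecidableEq α]

/-- The transposition of the two outermost points. -/
noncomputable def topSwap (α : Type*) [DecidableEq α] :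
    MonoidAlgebra ℂ (Perm (Option (Option α))) :=
  single (swap none (some none)) 1

theorem topSwap_mul_self : topSwap α * topSwap α = 1 := by
  rw [topSwap, single_mul_single, swap_mul_self, mul_one, MonoidAlgebra.one_def]

theorem condExp_topSwap : condExp (topSwap α) = 0 :=
  condExp_single_of_ne (by simp) _

/-- A permutation fixing both outer points commutes with their transposition. Otherwise its
conjugate still moves the outermost point, and both sides vanish. -/
theorem condExp_topSwap_conj (a : MonoidAlgebra ℂ (Perm (Option α))) :
    condExp (topSwap α * groupAlgInc a * topSwap α) = groupAlgInc (condExp a) := by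
  induction a using MonoidAlgebra.induction_linear with
  | zero => simp
  | add x y hx hy => simp only [map_add, mul_add, add_mul, hx, hy]
  | single σ r =>
    rw [groupAlgInc_single, topSwap, single_mul_single, single_mul_single, one_mul, mul_one]
    by_cases h : σ none = none
    · obtain ⟨σ, rfl⟩ := mem_range_permOption.2 h
      have : swap none (some none) * permOption (Option α) (permOption α σ) * swap none (some none)
          = permOption (Option α) (permOption α σ) := by
        ext1 x
        rcases x with _ | _ | x
        · simp [Perm.mul_apply]
        · simp [Perm.mul_apply]
        · have hx : ∀ y : α, swap none (some none) (some (some y)) = some (some y) :=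
            fun y => swap_apply_of_ne_of_ne (by simp) (by simp)
          simp [Perm.mul_apply, hx]
      rw [this, condExp_single_permOption, condExp_single_permOption, groupAlgInc_single]
    · rw [condExp_single_of_ne h, condExp_single_of_ne, map_zero]
      simp only [Perm.mul_apply, swap_apply_left, permOption_some]
      rw [swap_apply_of_ne_of_ne (by simp) (by simpa using h)]
      simp

theorem permOption_swap (a b : α) : permOption α (swap a b) = swap (some a) (some b) := by
  ext1 x
  rcases x with _ | x
  · rw [permOption_none, swap_apply_of_ne_of_ne (by simp) (by simp)]
  · rw [permOption_some, swap_apply_def, swap_apply_def]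
    simp only [Option.some.injEq]
    split_ifs <;> rfl

variable [Fintype α]

/-- This is the degenerate affine Hecke relation: conjugation by the top transposition replaces the
point `some none` by `none` in every other summand. -/
theorem jucysMurphy_option : jucysMurphy (Option α)
    = topSwap α * groupAlgInc (jucysMurphy α) * topSwap α + topSwap α := by
  rw [jucysMurphy, Fintype.sum_option, add_comm, jucysMurphy, map_sum, Finset.mul_sum,
    Finset.sum_mul]
  congr 1
  refine Finset.sum_congr rfl fun a _ => ?_
  rw [groupAlgInc_single, topSwap, single_mul_single, single_mul_single]
  congr 1
  · rw [permOption_swap, mul_swap_eq_swap_mul (swap none (some none)) (some none), mul_assoc,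
      swap_mul_self, mul_one, swap_apply_right, swap_apply_of_ne_of_ne (by simp) (by simp)]
  · simp

theorem commute_single_jucysMurphy (σ : Perm α) :
    Commute (single (permOption α σ) (1 : ℂ)) (jucysMurphy α) := by
  rw [Commute, SemiconjBy, jucysMurphy, Finset.mul_sum, Finset.sum_mul]
  refine Fintype.sum_equiv σ _ _ fun a => ?_
  rw [single_mul_single, single_mul_single]
  congr 1
  rw [mul_swap_eq_swap_mul]
  rfl

theorem commute_groupAlgInc_jucysMurphy (a : MonoidAlgebra ℂ (Perm α)) :
    Commute (groupAlgInc a) (jucysMurphy α) := by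
  induction a using MonoidAlgebra.induction_linear with
  | zero => simp
  | add x y hx hy => rw [map_add]; exact hx.add_left hy
  | single σ r =>
    have : single σ r = r • single σ (1 : ℂ) := by simp
    rw [this, map_smul, groupAlgInc_single]
    exact (commute_single_jucysMurphy σ).smul_left r

theorem commute_swapSum (σ : Perm α) : Commute (single σ (1 : ℂ)) (swapSum α) := by
  rw [Commute, SemiconjBy, swapSum, Finset.mul_sum, Finset.sum_mul]
  refine Fintype.sum_equiv σ _ _ fun a => ?_
  rw [Finset.mul_sum, Finset.sum_mul]
  refine Fintype.sum_equiv σ _ _ fun b => ?_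
  rw [single_mul_single, single_mul_single]
  congr 1
  rw [mul_swap_eq_swap_mul]

/-- Ordered pairs count each transposition twice and each diagonal pair as the identity, whence the
2 and the 1. So the Jucys–Murphy element is, up to affine terms, a difference of central elements of
two consecutive group algebras. -/
theorem swapSum_option : swapSum (Option α)
    = groupAlgInc (swapSum α) + (2 : ℂ) • jucysMurphy α + 1 := by
  simp only [swapSum, Fintype.sum_option, map_sum, groupAlgInc_single, permOption_swap,
    Finset.sum_add_distrib, swap_self, jucysMurphy, two_smul]
  have : ∀ a : α, swap (some a) none = swap none (some a) := fun a => swap_comm _ _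
  simp only [this, ← Perm.one_def, MonoidAlgebra.one_def]
  abel

/-- Here `P` and `Q` are resolvents of consecutive Jucys–Murphy elements. The first identity
compares the functions attached to neighbouring levels of the branching graph; the second yields the
reciprocal pair of rational functions after taking traces. -/
theorem condExp_resolvent {z : ℂ} {P : MonoidAlgebra ℂ (Perm (Option (Option α)))}
    {Q : MonoidAlgebra ℂ (Perm (Option α))}
    (hP : P * (algebraMap ℂ _ z - jucysMurphy (Option α)) = 1)
    (hP' : (algebraMap ℂ _ z - jucysMurphy (Option α)) * P = 1)
    (hQ : Q * (algebraMap ℂ _ z - jucysMurphy α) = 1)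
    (hQ' : (algebraMap ℂ _ z - jucysMurphy α) * Q = 1) :
    condExp P * (1 - Q * Q) = groupAlgInc (condExp Q) ∧
      algebraMap ℂ _ z * condExp P - ∑ o : Option α, single (swap none o) (1 : ℂ) *
        (Q * condExp P) * single (swap none o) (1 : ℂ) = 1 := by
  set s := topSwap α with hs
  have hss : s * s = 1 := topSwap_mul_self
  set J := groupAlgInc (jucysMurphy α) with hJ
  set K := jucysMurphy (Option α) with hK
  have hKJ : K = s * J * s + s := jucysMurphy_option
  set q := groupAlgInc Q with hq
  set ζ := algebraMap ℂ (MonoidAlgebra ℂ (Perm (Option (Option α)))) z with hζ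
  have hζc : ∀ x, ζ * x = x * ζ := fun x => Algebra.commutes z x
  have hq1 : q * (ζ - J) = 1 := by
    have := congrArg groupAlgInc hQ
    rwa [map_mul, map_sub, map_one, AlgHom.commutes] at this
  have hq2 : (ζ - J) * q = 1 := by
    have := congrArg groupAlgInc hQ'
    rwa [map_mul, map_sub, map_one, AlgHom.commutes] at this
  -- The top transposition intertwines the two shifted Jucys–Murphy elements up to 1; inverting both
  -- gives the commutation rules `Ps` and `sP`.
  have e1 : (ζ - K) * s = s * (ζ - J) - 1 := by
    rw [hKJ]
    calc (ζ - (s * J * s + s)) * s = ζ * s - s * J * (s * s) - s * s := by noncomm_ring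
      _ = _ := by rw [hss, hζc]; noncomm_ring
  have e2 : s * (ζ - K) = (ζ - J) * s - 1 := by
    rw [hKJ]
    calc s * (ζ - (s * J * s + s)) = s * ζ - (s * s) * J * s - s * s := by noncomm_ring
      _ = _ := by rw [hss, ← hζc]; noncomm_ring
  have Ps : P * s = s * q + P * q := by
    have : P * ((ζ - K) * s) * q = P * (s * (ζ - J) - 1) * q := by rw [e1]
    rw [← mul_assoc, hP, one_mul] at this
    have h2 : P * (s * (ζ - J) - 1) * q = P * s * ((ζ - J) * q) - P * q := by noncomm_ring
    rw [h2, hq2, mul_one] at this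
    rw [this]; noncomm_ring
  have sP : s * P = q * s + q * P := by
    have : q * (s * (ζ - K)) * P = q * ((ζ - J) * s - 1) * P := by rw [e2]
    rw [mul_assoc, mul_assoc, hP', mul_one] at this
    have h2 : q * ((ζ - J) * s - 1) * P = (q * (ζ - J)) * s * P - q * P := by noncomm_ring
    rw [h2, hq1, one_mul] at this
    rw [this]; noncomm_ring
  have hcomm : ∀ a, P * groupAlgInc a = groupAlgInc a * P := by
    intro a
    have hc : groupAlgInc a * (ζ - K) = (ζ - K) * groupAlgInc a := by
      rw [mul_sub, sub_mul, hζc, (commute_groupAlgInc_jucysMurphy a).eq]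
    calc P * groupAlgInc a = P * (groupAlgInc a * (ζ - K)) * P := by
          rw [mul_assoc, mul_assoc, hP', mul_one]
      _ = P * (ζ - K) * groupAlgInc a * P := by rw [hc]; noncomm_ring
      _ = _ := by rw [hP, one_mul]
  constructor
  · have hqP : P * q = q * P := hcomm Q
    have h1 : P * (1 - q * q) = s * q * s + q * s * q := by
      have : P = s * q * s + q * (s * q) + q * P * q := by
        calc P = (P * s) * s := by rw [mul_assoc, hss, mul_one]
          _ = s * q * s + q * (P * s) := by nth_rewrite 1 [Ps]; rw [add_mul, hqP, mul_assoc q P s]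
          _ = _ := by rw [Ps]; noncomm_ring
      have h3 : q * P * q = P * (q * q) := by rw [hq, ← hcomm]; noncomm_ring
      rw [h3] at this
      rw [mul_sub, mul_one, sub_eq_iff_eq_add]
      rw [mul_assoc q s q]
      exact this
    have h2 := congrArg condExp h1
    rw [map_add, condExp_topSwap_conj, hq, condExp_mul_groupAlgInc, condExp_groupAlgInc_mul,
      condExp_topSwap, mul_zero, zero_mul, add_zero] at h2
    rw [← h2, ← condExp_mul_groupAlgInc, map_sub groupAlgInc, map_one, map_mul groupAlgInc]
  · have hE : condExp (s * P) = Q * condExp P := by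
      rw [sP, map_add, hq, condExp_groupAlgInc_mul, condExp_groupAlgInc_mul, condExp_topSwap,
        mul_zero, zero_add]
    have hz : algebraMap ℂ _ z * condExp P = condExp (ζ * P) := by
      rw [← condExp_groupAlgInc_mul]; rw [AlgHom.commutes]
    have hKP : condExp (K * P) = ∑ o : Option α, single (swap none o) (1 : ℂ) *
        (Q * condExp P) * single (swap none o) (1 : ℂ) := by
      rw [hK, jucysMurphy, Finset.sum_mul, map_sum]
      refine Finset.sum_congr rfl fun o _ => ?_
      -- Every summand of `K` is conjugate to `s` under the smaller group; for `o = none` the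
      -- conjugating element `swap none none` is the identity.
      have : (single (swap none (some o)) (1 : ℂ) : MonoidAlgebra ℂ (Perm (Option (Option α))))
          = groupAlgInc (single (swap none o) 1) * s * groupAlgInc (single (swap none o) 1) := by
        rw [groupAlgInc_single, hs, topSwap, single_mul_single, single_mul_single, permOption_swap]
        congr 1
        · rcases o with _ | o
          · ext1 x; simp
          · have h := swap_mul_swap_mul_swap (x := (none : Option (Option α))) (y := some none)
              (z := some (some o)) (by simp) (by simp)
            rw [h, swap_comm]
        · simp
      rw [this, mul_assoc, ← hcomm, ← mul_assoc, condExp_mul_groupAlgInc, mul_assoc,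
        condExp_groupAlgInc_mul, hE]
    rw [hz, ← hKP, ← map_sub, ← sub_mul, hP', condExp_one]

theorem commute_condExp {P : MonoidAlgebra ℂ (Perm (Option α))} {z : ℂ}
    (hP : P * (algebraMap ℂ _ z - jucysMurphy α) = 1)
    (hP' : (algebraMap ℂ _ z - jucysMurphy α) * P = 1) (a : MonoidAlgebra ℂ (Perm α)) :
    Commute (groupAlgInc a) P ∧ Commute a (condExp P) := by
  have hc : groupAlgInc a * (algebraMap ℂ _ z - jucysMurphy α)
      = (algebraMap ℂ _ z - jucysMurphy α) * groupAlgInc a := by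
    rw [mul_sub, sub_mul, Algebra.commutes, (commute_groupAlgInc_jucysMurphy a).eq]
  have h1 : groupAlgInc a * P = P * groupAlgInc a := by
    calc groupAlgInc a * P = P * (algebraMap ℂ _ z - jucysMurphy α) * groupAlgInc a * P := by
          rw [hP, one_mul]
      _ = P * (groupAlgInc a * (algebraMap ℂ _ z - jucysMurphy α)) * P := by
          rw [hc]; noncomm_ring
      _ = _ := by rw [mul_assoc, mul_assoc, hP', mul_one]
  refine ⟨h1, ?_⟩
  rw [Commute, SemiconjBy, ← condExp_groupAlgInc_mul, h1, condExp_mul_groupAlgInc]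

end Relations

/-- The exceptional z are the eigenvalues of left multiplication by x, finitely many in finite
dimension. -/
theorem exists_resolvent {A : Type*} [Ring A] [Algebra ℂ A] [FiniteDimensional ℂ A] (x : A) :
    ∃ F : Set ℂ, F.Finite ∧ ∀ z, z ∉ F → ∃ q : A, q * (algebraMap ℂ A z - x) = 1 ∧
      (algebraMap ℂ A z - x) * q = 1 := by
  refine ⟨spectrum ℂ (Algebra.lmul ℂ A x), Module.End.finite_spectrum _, fun z hz => ?_⟩
  rw [spectrum.mem_iff, not_not] at hz
  obtain ⟨u, hu⟩ := hz
  have hval : ∀ v, (u : Module.End ℂ A) v = (algebraMap ℂ A z - x) * v := by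
    intro v
    rw [hu]
    simp [sub_mul, Algebra.smul_def]
  have h1 : (algebraMap ℂ A z - x) * ((↑u⁻¹ : Module.End ℂ A) 1) = 1 := by
    rw [← hval, ← Module.End.mul_apply, Units.mul_inv, Module.End.one_apply]
  refine ⟨(↑u⁻¹ : Module.End ℂ A) 1, ?_, h1⟩
  have hinj : ∀ v w, (u : Module.End ℂ A) v = (u : Module.End ℂ A) w → v = w := by
    intro v w h
    have := congrArg (↑u⁻¹ : Module.End ℂ A) h
    rwa [← Module.End.mul_apply, ← Module.End.mul_apply, Units.inv_mul] at this
  apply hinj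
  rw [hval, hval, ← mul_assoc, h1]
  simp

/-! ### Irreducibility, Schur's lemma, irreducible subrepresentations and quotients. -/

section Irreducible

variable {G : Type*} [Group G] {V : Type*} [AddCommGroup V] [Module ℂ V]
  {ρ : Representation ℂ G V}

theorem isIrreducible_iff_invariant : ρ.IsIrreducible ↔ Nontrivial V ∧
    ∀ U : Submodule ℂ V, (∀ g, ∀ v ∈ U, ρ g v ∈ U) → U = ⊥ ∨ U = ⊤ := by
  constructor
  · intro h
    refine ⟨?_, fun U hU => ?_⟩
    · by_contra hV
      rw [not_nontrivial_iff_subsingleton] at hV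
      obtain ⟨a, b, hab⟩ := h.exists_pair_ne
      exact hab (Subrepresentation.toSubmodule_injective (Subsingleton.elim _ _))
    · rcases h.eq_bot_or_eq_top ⟨U, hU⟩ with h' | h'
      · exact Or.inl (congrArg Subrepresentation.toSubmodule h')
      · exact Or.inr (congrArg Subrepresentation.toSubmodule h')
  · rintro ⟨hV, h⟩
    have : Nontrivial (Subrepresentation ρ) :=
      ⟨⊥, ⊤, fun h' => bot_ne_top (α := Submodule ℂ V)
        (congrArg Subrepresentation.toSubmodule h')⟩
    refine { eq_bot_or_eq_top := fun U => ?_ }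
    rcases h U.toSubmodule U.apply_mem_toSubmodule with h' | h'
    · exact Or.inl (Subrepresentation.toSubmodule_injective h')
    · exact Or.inr (Subrepresentation.toSubmodule_injective h')

theorem Representation.IsIrreducible.exists_eq_smul_one [FiniteDimensional ℂ V]
    (h : ρ.IsIrreducible) (f : Module.End ℂ V) (hf : ∀ g, Commute (ρ g) f) :
    ∃ c : ℂ, f = c • 1 := by
  obtain ⟨hV, hirr⟩ := isIrreducible_iff_invariant.1 h
  obtain ⟨c, hc⟩ := Module.End.exists_eigenvalue f
  refine ⟨c, ?_⟩
  have hinv : ∀ g, ∀ v ∈ f.eigenspace c, ρ g v ∈ f.eigenspace c := by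
    intro g v hv
    rw [Module.End.mem_eigenspace_iff] at hv ⊢
    have := congrArg (fun e : Module.End ℂ V => e v) (hf g)
    simp only [Module.End.mul_apply] at this
    rw [← this, hv, map_smul]
  rcases hirr (f.eigenspace c) hinv with h' | h'
  · exact absurd h' hc
  · ext v
    have : v ∈ f.eigenspace c := h' ▸ Submodule.mem_top
    simpa [Module.End.mem_eigenspace_iff] using this

theorem commute_asAlgebraHom {a : MonoidAlgebra ℂ G} (h : ∀ g, Commute (single g (1 : ℂ)) a)
    (g : G) : Commute (ρ g) (ρ.asAlgebraHom a) := by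
  have := (h g).map ρ.asAlgebraHom
  rwa [Representation.asAlgebraHom_single_one] at this

/-- A nonzero invariant submodule of finite dimension contains an irreducible one. -/
theorem exists_irreducible_le [FiniteDimensional ℂ V] (N : Submodule ℂ V) (hN : N ≠ ⊥)
    (hinv : ∀ g, ∀ v ∈ N, ρ g v ∈ N) :
    ∃ U : Subrepresentation ρ, U.toSubmodule ≤ N ∧ U.toRepresentation.IsIrreducible := by
  let S : Set (Submodule ℂ V) := {U | U ≤ N ∧ U ≠ ⊥ ∧ ∀ g, ∀ v ∈ U, ρ g v ∈ U}
  obtain ⟨U, ⟨hUN, hU, hUinv⟩, hmin⟩ :=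
    WellFounded.has_min (wellFounded_lt (α := Submodule ℂ V)) S ⟨N, le_rfl, hN, hinv⟩
  refine ⟨⟨U, hUinv⟩, hUN, isIrreducible_iff_invariant.2
    ⟨Submodule.nontrivial_iff_ne_bot.2 hU, fun M hM => ?_⟩⟩
  by_contra! hcon
  have hle : M.map U.subtype ≤ U := Submodule.map_subtype_le U M
  refine hmin (M.map U.subtype) ⟨hle.trans hUN, ?_, ?_⟩ (lt_of_le_of_ne hle ?_)
  · intro h
    exact hcon.1 (Submodule.map_injective_of_injective U.injective_subtype
      (h.trans (Submodule.map_bot _).symm))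
  · rintro g v ⟨w, hw, rfl⟩
    exact ⟨_, hM g w hw, rfl⟩
  · intro h
    apply hcon.2
    rw [eq_top_iff]
    rintro ⟨x, hx⟩ -
    obtain ⟨w, hw, hwx⟩ : x ∈ M.map U.subtype := h.symm ▸ hx
    have : w = ⟨x, hx⟩ := Subtype.ext hwx
    rwa [← this]

/-- A proper invariant submodule of finite codimension lies in the kernel of an equivariant
surjection onto an irreducible representation. -/
theorem exists_irreducible_quotient [FiniteDimensional ℂ V] (N : Submodule ℂ V) (hN : N ≠ ⊤)
    (hinv : ∀ g, ∀ v ∈ N, ρ g v ∈ N) :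
    ∃ (U : Submodule ℂ V) (σ : Representation ℂ G (V ⧸ U)), N ≤ U ∧ U ≠ ⊤ ∧ σ.IsIrreducible ∧
      ∀ g v, σ g (U.mkQ v) = U.mkQ (ρ g v) := by
  let S : Set (Submodule ℂ V) := {U | N ≤ U ∧ U ≠ ⊤ ∧ ∀ g, ∀ v ∈ U, ρ g v ∈ U}
  obtain ⟨U, ⟨hUN, hU, hUinv⟩, hmin⟩ :=
    WellFounded.has_min (wellFounded_gt (α := Submodule ℂ V)) S ⟨N, le_rfl, hN, hinv⟩
  refine ⟨U, ρ.quotient U hUinv, hUN, hU, isIrreducible_iff_invariant.2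
    ⟨Submodule.Quotient.nontrivial_iff.2 hU, fun M hM => ?_⟩, fun g v => rfl⟩
  by_contra! hcon
  have hle : U ≤ M.comap U.mkQ := by
    intro u hu
    have : U.mkQ u = 0 := by simpa using hu
    rw [Submodule.mem_comap, this]
    exact M.zero_mem
  refine hmin (M.comap U.mkQ) ⟨hUN.trans hle, ?_, ?_⟩ (lt_of_le_of_ne hle ?_)
  · intro h
    apply hcon.2
    rw [eq_top_iff]
    rintro x -
    obtain ⟨v, rfl⟩ := U.mkQ_surjective x
    have : v ∈ M.comap U.mkQ := h ▸ Submodule.mem_top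
    exact this
  · intro g v hv
    exact hM g _ hv
  · intro h
    apply hcon.1
    rw [eq_bot_iff]
    intro x hx
    obtain ⟨v, rfl⟩ := U.mkQ_surjective x
    have : v ∈ U := h ▸ hx
    simpa using this

end Irreducible

/-! ### Algebraic multiplicities and traces of resolvents. -/

section Trace

variable {V : Type*} [AddCommGroup V] [Module ℂ V] [FiniteDimensional ℂ V]

/-- The algebraic multiplicity of `μ` as an eigenvalue of `T`. -/
noncomputable def algMult (T : Module.End ℂ V) (μ : ℂ) : ℕ :=
  Module.finrank ℂ (T.maxGenEigenspace μ)

theorem finite_maxGenEigenspace_ne_bot (T : Module.End ℂ V) :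
    {μ | T.maxGenEigenspace μ ≠ ⊥}.Finite :=
  WellFoundedGT.finite_ne_bot_of_iSupIndep T.independent_maxGenEigenspace

/-- The finite set of eigenvalues of `T`. -/
noncomputable def eigenvalueFinset (T : Module.End ℂ V) : Finset ℂ :=
  (finite_maxGenEigenspace_ne_bot T).toFinset

theorem mem_eigenvalueFinset {T : Module.End ℂ V} {μ : ℂ} :
    μ ∈ eigenvalueFinset T ↔ algMult T μ ≠ 0 := by
  simp [eigenvalueFinset, algMult, Submodule.finrank_eq_zero]

theorem isInternal_maxGenEigenspace (T : Module.End ℂ V) :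
    DirectSum.IsInternal T.maxGenEigenspace :=
  DirectSum.isInternal_submodule_of_iSupIndep_of_iSup_eq_top
    T.independent_maxGenEigenspace T.iSup_maxGenEigenspace_eq_top

theorem exists_eigenvector {T : Module.End ℂ V} {μ : ℂ} (h : algMult T μ ≠ 0) :
    ∃ v, v ≠ 0 ∧ T v = μ • v := by
  have h1 : T.maxGenEigenspace μ ≠ ⊥ := by
    rwa [algMult, Ne, Submodule.finrank_eq_zero] at h
  have h2 : T.HasUnifEigenvalue μ ⊤ := h1
  have h3 : T.HasEigenvalue μ := h2.lt (by simp)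
  obtain ⟨v, hv⟩ := h3.exists_hasEigenvector
  exact ⟨v, hv.2, hv.apply_eq_smul⟩

/-- No diagonalisability is needed: on the generalised eigenspace of μ the nilpotent part of T
contributes no trace, so tr(BT) = μ tr B there, while zB - BT = 1. -/
theorem trace_resolvent {T B : Module.End ℂ V} {z : ℂ}
    (h1 : B * (algebraMap ℂ _ z - T) = 1) (h2 : (algebraMap ℂ _ z - T) * B = 1) :
    LinearMap.trace ℂ V B = ∑ μ ∈ eigenvalueFinset T, (algMult T μ : ℂ) / (z - μ) := by
  have hcomm : Commute T B := by
    have h3 : T * (algebraMap ℂ _ z - T) = (algebraMap ℂ _ z - T) * T := by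
      rw [mul_sub, sub_mul, Algebra.commutes]
    calc T * B = B * ((algebraMap ℂ _ z - T) * T) * B := by rw [← mul_assoc, h1, one_mul]
      _ = B * T * ((algebraMap ℂ _ z - T) * B) := by rw [← h3]; noncomm_ring
      _ = _ := by rw [h2, mul_one]
  have hmaps := fun μ => T.mapsTo_maxGenEigenspace_of_comm hcomm μ
  rw [LinearMap.trace_eq_sum_trace_restrict' (isInternal_maxGenEigenspace T)
    (finite_maxGenEigenspace_ne_bot T) hmaps]
  refine Finset.sum_congr rfl fun μ hμ => ?_
  obtain ⟨v, hv0, hv⟩ := exists_eigenvector (mem_eigenvalueFinset.1 hμ)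
  have hz : z - μ ≠ 0 := by
    intro h0
    have h4 := congrArg (fun e : Module.End ℂ V => e v) h1
    simp only [Module.End.mul_apply, LinearMap.sub_apply, Module.algebraMap_end_apply, hv,
      Module.End.one_apply, ← sub_smul, h0, zero_smul, map_zero] at h4
    exact hv0 h4.symm
  rw [eq_div_iff hz]
  have hT := T.mapsTo_maxGenEigenspace_of_comm (Commute.refl T) μ
  have hc : Commute (B.restrict (hmaps μ)) (T.restrict hT) :=
    LinearMap.restrict_commute hcomm.symm _ _
  have h5 := LinearMap.trace_comp_eq_mul_of_commute_of_isNilpotent μ hc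
    (T.isNilpotent_restrict_maxGenEigenspace_sub_algebraMap μ)
  have h6 : z • B.restrict (hmaps μ) - B.restrict (hmaps μ) ∘ₗ T.restrict hT = 1 := by
    ext w
    have h7 := congrArg (fun e : Module.End ℂ V => e (w : V)) h1
    simp only [Module.End.mul_apply, LinearMap.sub_apply, Module.algebraMap_end_apply,
      Module.End.one_apply, map_sub, map_smul] at h7
    exact h7
  have h8 := congrArg (LinearMap.trace ℂ _) h6
  rw [map_sub, map_smul, h5, LinearMap.trace_one, smul_eq_mul] at h8
  rw [algMult, ← h8]
  ring

/-- (1 + f)/2 is a projection, so its trace is its rank. -/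
theorem trace_im_eq_zero_of_mul_self_eq_one {f : Module.End ℂ V} (hf : f * f = 1) :
    (LinearMap.trace ℂ V f).im = 0 := by
  set p : Module.End ℂ V := (1 / 2 : ℂ) • (1 + f) with hp
  have hpp : IsIdempotentElem p := by
    rw [IsIdempotentElem, hp, smul_mul_smul_comm, mul_add, add_mul, add_mul, hf, one_mul, mul_one,
      one_mul]
    module
  have hproj : LinearMap.IsProj (LinearMap.range p) p :=
    ⟨fun x => ⟨x, rfl⟩, by
      rintro _ ⟨y, rfl⟩
      exact congrArg (fun e : Module.End ℂ V => e y) hpp⟩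
  have h1 := hproj.trace
  have h2 : f = (2 : ℂ) • p - 1 := by rw [hp]; module
  rw [h2, map_sub, map_smul, h1, LinearMap.trace_one]
  simp

theorem trace_pi {ι W : Type*} [Fintype ι] [DecidableEq ι] [AddCommGroup W] [Module ℂ W]
    [FiniteDimensional ℂ W] (f : Module.End ℂ (ι → W)) :
    LinearMap.trace ℂ (ι → W) f = ∑ i, LinearMap.trace ℂ W
      (LinearMap.proj i ∘ₗ f ∘ₗ LinearMap.single ℂ (fun _ => W) i) := by
  have h : f = ∑ i, (f ∘ₗ LinearMap.single ℂ (fun _ => W) i) ∘ₗ LinearMap.proj i := by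
    refine LinearMap.ext fun v => ?_
    have hv : v = ∑ i, Pi.single i (v i) := (Finset.univ_sum_single v).symm
    simp only [LinearMap.sum_apply, LinearMap.comp_apply, LinearMap.proj_apply,
      LinearMap.single_apply]
    conv_lhs => rw [hv, map_sum]
  conv_lhs => rw [h, map_sum]
  exact Finset.sum_congr rfl fun i _ => LinearMap.trace_comp_comm' _ _

end Trace

/-! ### The real scalar given by the sum of transpositions. -/

section SwapScalar

variable {α : Type*} [Fintype α] [DecidableEq α] {V : Type*} [AddCommGroup V] [Module ℂ V]

/-- The scalar by which `swapSum` acts on an irreducible representation. -/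
noncomputable def swapScalar (ρ : Representation ℂ (Perm α) V) : ℝ :=
  (LinearMap.trace ℂ V (ρ.asAlgebraHom (swapSum α))).re / Module.finrank ℂ V

theorem asAlgebraHom_swapSum [FiniteDimensional ℂ V] {ρ : Representation ℂ (Perm α) V}
    (h : ρ.IsIrreducible) : ρ.asAlgebraHom (swapSum α) = ((swapScalar ρ : ℝ) : ℂ) • 1 := by
  obtain ⟨c, hc⟩ := h.exists_eq_smul_one _ (commute_asAlgebraHom (ρ := ρ) commute_swapSum)
  have := (isIrreducible_iff_invariant.1 h).1
  have hd : (Module.finrank ℂ V : ℝ) ≠ 0 := Nat.cast_ne_zero.2 Module.finrank_pos.ne'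
  have him : (LinearMap.trace ℂ V (ρ.asAlgebraHom (swapSum α))).im = 0 := by
    simp only [swapSum, map_sum, Representation.asAlgebraHom_single_one, Complex.im_sum]
    refine Finset.sum_eq_zero fun a _ => Finset.sum_eq_zero fun b _ => ?_
    apply trace_im_eq_zero_of_mul_self_eq_one
    rw [← map_mul, swap_mul_self, map_one]
  have htr : LinearMap.trace ℂ V (ρ.asAlgebraHom (swapSum α)) = c * Module.finrank ℂ V := by
    rw [hc, map_smul, LinearMap.trace_one, smul_eq_mul]
  rw [htr] at him
  have hcim : c.im = 0 := by
    have : c.im * (Module.finrank ℂ V : ℝ) = 0 := by simpa using him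
    exact (mul_eq_zero.1 this).resolve_right hd
  rw [hc]
  congr 1
  apply Complex.ext
  · rw [Complex.ofReal_re, swapScalar, htr]
    rw [eq_div_iff hd]
    simp
  · simp [hcim]

end SwapScalar

/-! ### Left translation and the coinduced module. -/

section LeftTranslation

variable {G : Type*} [Group G] [Fintype G] (W : Type*) [AddCommGroup W] [Module ℂ W]

/-- The action of the group algebra on functions `G → W` by left translation of the argument. -/
noncomputable def leftTrans : MonoidAlgebra ℂ G →ₗ[ℂ] Module.End ℂ (G → W) where
  toFun a := ∑ k, a.coeff k • LinearMap.funLeft ℂ W (k * ·)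
  map_add' a b := by simp [add_smul, Finset.sum_add_distrib]
  map_smul' c a := by simp [mul_smul, Finset.smul_sum]

variable {W}

theorem leftTrans_apply (a : MonoidAlgebra ℂ G) (f : G → W) (g : G) :
    leftTrans W a f g = ∑ k, a.coeff k • f (k * g) := by
  simp [leftTrans, LinearMap.funLeft_apply]

theorem leftTrans_single_apply (k : G) (r : ℂ) (f : G → W) (g : G) :
    leftTrans W (single k r) f g = r • f (k * g) := by
  classical
  rw [leftTrans_apply, Finset.sum_eq_single k]
  · simp
  · intro b _ hb
    simp [hb.symm]
  · simp

theorem leftTrans_mul (a b : MonoidAlgebra ℂ G) :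
    leftTrans W (a * b) = leftTrans W b * leftTrans W a := by
  induction a using MonoidAlgebra.induction_linear with
  | zero => simp
  | add x y hx hy => simp only [map_add, add_mul, mul_add, hx, hy]
  | single σ r =>
    induction b using MonoidAlgebra.induction_linear with
    | zero => simp
    | add x y hx hy => simp only [map_add, mul_add, add_mul, hx, hy]
    | single τ t =>
      refine LinearMap.ext fun f => funext fun g => ?_
      rw [single_mul_single, Module.End.mul_apply, leftTrans_single_apply, leftTrans_single_apply,
        leftTrans_single_apply, smul_smul, mul_comm r t, mul_assoc]

theorem leftTrans_one : leftTrans W (1 : MonoidAlgebra ℂ G) = 1 := by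
  refine LinearMap.ext fun f => funext fun g => ?_
  rw [MonoidAlgebra.one_def, leftTrans_single_apply, one_smul, one_mul, Module.End.one_apply]

end LeftTranslation

section Coinduction

variable {α : Type*} [Fintype α] [DecidableEq α] {W : Type*} [AddCommGroup W] [Module ℂ W]
  (σ : Representation ℂ (Perm α) W)

theorem leftTrans_groupAlgInc {f : Perm (Option α) → W}
    (hf : f ∈ Representation.coindV (permOption α) σ) (b : MonoidAlgebra ℂ (Perm α))
    (g : Perm (Option α)) :
    leftTrans W (groupAlgInc b) f g = σ.asAlgebraHom b (f g) := by
  induction b using MonoidAlgebra.induction_linear with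
  | zero => simp
  | add x y hx hy => simp only [map_add, LinearMap.add_apply, Pi.add_apply, hx, hy]
  | single τ r =>
    rw [groupAlgInc_single, leftTrans_single_apply, Representation.asAlgebraHom_single, hf]
    rfl

theorem leftTrans_mem_coindV {a : MonoidAlgebra ℂ (Perm (Option α))}
    (ha : ∀ b, Commute (groupAlgInc b) a) {f : Perm (Option α) → W}
    (hf : f ∈ Representation.coindV (permOption α) σ) :
    leftTrans W a f ∈ Representation.coindV (permOption α) σ := by
  intro h g
  have h1 : ∀ f' : Perm (Option α) → W, f' (permOption α h * g)
      = leftTrans W (groupAlgInc (single h 1)) f' g := by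
    intro f'
    rw [groupAlgInc_single, leftTrans_single_apply, one_smul]
  rw [h1 (leftTrans W a f), ← Module.End.mul_apply, ← leftTrans_mul, ← (ha _).eq, leftTrans_mul,
    Module.End.mul_apply]
  have h2 : leftTrans W (groupAlgInc (single h 1)) f = (σ h).compLeft (Perm (Option α)) f := by
    funext g'
    rw [leftTrans_groupAlgInc σ hf, Representation.asAlgebraHom_single_one]
    rfl
  rw [h2, leftTrans_apply, leftTrans_apply, map_sum]
  refine Finset.sum_congr rfl fun k _ => ?_
  rw [map_smul]
  rfl

/-- The restriction of `leftTrans` to the coinduced module. -/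
noncomputable def coindTrans (a : MonoidAlgebra ℂ (Perm (Option α)))
    (ha : ∀ b, Commute (groupAlgInc b) a) :
    Module.End ℂ (Representation.coindV (permOption α) σ) :=
  (leftTrans W a).restrict fun _ => leftTrans_mem_coindV σ ha

theorem card_perm_option : (Fintype.card (Perm (Option α)) : ℂ)
    = (Fintype.card α + 1) * Fintype.card (Perm α) := by
  rw [Fintype.card_perm, Fintype.card_perm, Fintype.card_option, Nat.factorial_succ]
  push_cast
  ring

/-- The analogue of the induced character formula. Together with Schur's lemma it identifies the
scalar by which a conditional expectation acts. -/
theorem trace_coindTrans [FiniteDimensional ℂ W] (a : MonoidAlgebra ℂ (Perm (Option α)))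
    (ha : ∀ b, Commute (groupAlgInc b) a) :
    LinearMap.trace ℂ _ (coindTrans σ a ha)
      = (Fintype.card α + 1) * LinearMap.trace ℂ W (σ.asAlgebraHom (condExp a)) := by
  have hcard : (Fintype.card (Perm α) : ℂ) ≠ 0 := Nat.cast_ne_zero.2 Fintype.card_ne_zero
  -- Averaging over the subgroup projects all functions onto the coinduced ones, so the trace can be
  -- computed on the full function space.
  let π : Module.End ℂ (Perm (Option α) → W) :=
    (Fintype.card (Perm α) : ℂ)⁻¹ • ∑ h : Perm α,
      (σ h⁻¹).compLeft (Perm (Option α)) ∘ₗ LinearMap.funLeft ℂ W (permOption α h * ·)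
  have hπ : ∀ f g, π f g = (Fintype.card (Perm α) : ℂ)⁻¹ •
      ∑ h : Perm α, σ h⁻¹ (f (permOption α h * g)) := by
    intro f g
    simp [π, LinearMap.funLeft_apply]
  have hπmem : ∀ f, π f ∈ Representation.coindV (permOption α) σ := by
    intro f k g
    rw [hπ, hπ, map_smul, map_sum]
    congr 1
    refine Fintype.sum_equiv (Equiv.mulRight k) _ _ fun h => ?_
    rw [Equiv.coe_mulRight, mul_inv_rev, map_mul, map_mul, ← Module.End.mul_apply, ← mul_assoc (σ k),
      ← map_mul σ k, mul_inv_cancel, map_one, one_mul, mul_assoc]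
  have hπid : ∀ f ∈ Representation.coindV (permOption α) σ, π f = f := by
    intro f hf
    funext g
    rw [hπ]
    have : ∀ h, σ h⁻¹ (f (permOption α h * g)) = f g := by
      intro h
      rw [hf, ← Module.End.mul_apply, ← map_mul, inv_mul_cancel, map_one, Module.End.one_apply]
    simp only [this, Finset.sum_const, Finset.card_univ]
    rw [← Nat.cast_smul_eq_nsmul ℂ, smul_smul, inv_mul_cancel₀ hcard, one_smul]
  have hmem : ∀ f, (leftTrans W a * π) f ∈ Representation.coindV (permOption α) σ :=
    fun f => leftTrans_mem_coindV σ ha (hπmem f)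
  have h1 : coindTrans σ a ha = (leftTrans W a * π).restrict (fun f _ => hmem f) := by
    ext1 f
    apply Subtype.ext
    change leftTrans W a f = leftTrans W a (π f)
    rw [hπid _ f.2]
  rw [h1, LinearMap.trace_restrict_eq_of_forall_mem _ _
    hmem, trace_pi]
  -- All diagonal blocks coincide: only translations by elements of the subgroup return to g, which
  -- is what `condExp` keeps.
  have h2 : ∀ g : Perm (Option α), (LinearMap.proj g ∘ₗ (leftTrans W a * π) ∘ₗ
      LinearMap.single ℂ (fun _ => W) g : Module.End ℂ W)
      = (Fintype.card (Perm α) : ℂ)⁻¹ • σ.asAlgebraHom (condExp a) := by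
    intro g
    ext1 w
    have h3 : ∀ k : Perm (Option α), ∀ h : Perm α,
        (Pi.single g w : Perm (Option α) → W) (permOption α h * (k * g))
          = if k = permOption α h⁻¹ then w else 0 := by
      intro k h
      rw [Pi.single_apply, ← mul_assoc]
      refine if_congr ?_ rfl rfl
      rw [mul_eq_right, map_inv, mul_eq_one_iff_eq_inv']
    change leftTrans W a (π (Pi.single g w)) g = _
    rw [leftTrans_apply]
    simp only [hπ, h3]
    have h4 : ∀ (k : Perm (Option α)) (h : Perm α), σ h⁻¹ (if k = permOption α h⁻¹ then w else 0)
        = if k = permOption α h⁻¹ then σ h⁻¹ w else 0 := by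
      intro k h
      split_ifs <;> simp
    simp only [h4, Finset.smul_sum, smul_ite, smul_zero]
    rw [Finset.sum_comm]
    simp only [Finset.sum_ite_eq', Finset.mem_univ, if_true]
    rw [Representation.asAlgebraHom_def, MonoidAlgebra.lift_apply, LinearMap.smul_apply,
      Finsupp.sum_fintype _ _ (by simp), LinearMap.sum_apply, Finset.smul_sum]
    refine Fintype.sum_equiv (Equiv.inv (Perm α)) _ _ fun h => ?_
    rw [condExp_coeff, LinearMap.smul_apply, smul_comm]
    rfl
  simp only [h2, map_smul, Finset.sum_const, Finset.card_univ, smul_eq_mul, nsmul_eq_mul]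
  rw [card_perm_option]
  field_simp

/-- The operator on the coinduced module given by the Jucys–Murphy element. -/
noncomputable def coindJM : Module.End ℂ (Representation.coindV (permOption α) σ) :=
  coindTrans σ (jucysMurphy α) commute_groupAlgInc_jucysMurphy

/-- `swapSum` is invariant under conjugation, so left and right translation by it agree. -/
theorem leftTrans_swapSum (f : Perm (Option α) → W) (g : Perm (Option α)) :
    leftTrans W (swapSum (Option α)) f g = ∑ a, ∑ b, f (g * swap a b) := by
  simp only [swapSum, map_sum, LinearMap.sum_apply, Finset.sum_apply, leftTrans_single_apply,
    one_smul]
  refine Fintype.sum_equiv g⁻¹ _ _ fun a => Fintype.sum_equiv g⁻¹ _ _ fun b => ?_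
  rw [mul_swap_eq_swap_mul]
  simp

theorem coind_swapSum_apply (f : Representation.coindV (permOption α) σ)
    (g : Perm (Option α)) :
    ((Representation.coind (permOption α) σ).asAlgebraHom (swapSum (Option α)) f).1 g
      = ∑ a, ∑ b, f.1 (g * swap a b) := by
  simp only [swapSum, map_sum, Representation.asAlgebraHom_single_one, LinearMap.sum_apply,
    AddSubmonoidClass.coe_finsetSum, Finset.sum_apply]
  rfl

/-- The operator `coindJM` is an affine function of the action of `swapSum`. -/
theorem coindJM_eq [FiniteDimensional ℂ W] (hσ : σ.IsIrreducible) :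
    coindJM σ = (1 / 2 : ℂ) • ((Representation.coind (permOption α) σ).asAlgebraHom
      (swapSum (Option α)) - ((swapScalar σ + 1 : ℝ) : ℂ) • 1) := by
  refine LinearMap.ext fun f => Subtype.ext (funext fun g => ?_)
  have h1 : leftTrans W (swapSum (Option α)) f.1 g
      = ((swapScalar σ : ℝ) : ℂ) • f.1 g + (2 : ℂ) • leftTrans W (jucysMurphy α) f.1 g
        + f.1 g := by
    rw [swapSum_option, map_add, map_add, map_smul, leftTrans_one]
    simp only [LinearMap.add_apply, Pi.add_apply, LinearMap.smul_apply, Pi.smul_apply,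
      Module.End.one_apply]
    rw [leftTrans_groupAlgInc σ f.2, asAlgebraHom_swapSum hσ]
    rfl
  change leftTrans W (jucysMurphy α) f.1 g = (1 / 2 : ℂ) • (((Representation.coind
    (permOption α) σ).asAlgebraHom (swapSum (Option α)) f).1 g
      - ((swapScalar σ + 1 : ℝ) : ℂ) • f.1 g)
  rw [coind_swapSum_apply, ← leftTrans_swapSum, h1]
  push_cast
  module

theorem commute_coindJM [FiniteDimensional ℂ W] (hσ : σ.IsIrreducible) (g : Perm (Option α)) :
    Commute (Representation.coind (permOption α) σ g) (coindJM σ) := by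
  rw [coindJM_eq σ hσ]
  have h1 := commute_asAlgebraHom (ρ := Representation.coind (permOption α) σ)
    commute_swapSum g
  refine LinearMap.ext fun f => ?_
  have h2 := LinearMap.congr_fun h1 f
  simp only [Module.End.mul_apply] at h2
  change Representation.coind (permOption α) σ g ((1 / 2 : ℂ) •
    (_ - ((swapScalar σ + 1 : ℝ) : ℂ) • f)) = (1 / 2 : ℂ) •
    (_ - ((swapScalar σ + 1 : ℝ) : ℂ) • Representation.coind (permOption α) σ g f)
  rw [map_smul, map_sub, map_smul, h2]

theorem finrank_coindV [FiniteDimensional ℂ W] :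
    (Module.finrank ℂ (Representation.coindV (permOption α) σ) : ℂ)
      = (Fintype.card α + 1) * Module.finrank ℂ W := by
  have h := trace_coindTrans σ 1 (fun b => Commute.one_right _)
  have h1 : coindTrans σ 1 (fun b => Commute.one_right _) = 1 := by
    refine LinearMap.ext fun f => Subtype.ext ?_
    change leftTrans W 1 f.1 = f.1
    rw [leftTrans_one]
    rfl
  rwa [h1, LinearMap.trace_one, condExp_one, map_one, LinearMap.trace_one] at h

end Coinduction

end

section

open Equiv MonoidAlgebra Filter Topology

/-! ### Residues of partial fractions. -/

theorem tendsto_residue {S : Finset ℂ} {c : ℂ → ℂ} (y : ℂ) (hc : y ∉ S → c y = 0) :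
    Tendsto (fun z => (z - y) * ∑ w ∈ S, c w / (z - w)) (𝓝[≠] y) (𝓝 (c y)) := by
  classical
  have h1 : ∀ w ∈ S, Tendsto (fun z => (z - y) * (c w / (z - w))) (𝓝[≠] y)
      (𝓝 (if w = y then c y else 0)) := by
    intro w _
    split_ifs with h
    · subst h
      refine Tendsto.congr' ?_ tendsto_const_nhds
      filter_upwards [self_mem_nhdsWithin] with z hz
      have : z - w ≠ 0 := sub_ne_zero.2 hz
      field_simp
    · have h2 : ContinuousAt (fun z => (z - y) * (c w / (z - w))) y := by
        have : y - w ≠ 0 := sub_ne_zero.2 (Ne.symm h)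
        fun_prop (disch := assumption)
      have h3 := h2.tendsto
      simp only [sub_self, zero_mul] at h3
      exact h3.mono_left nhdsWithin_le_nhds
  have h2 := tendsto_finsetSum S h1
  simp only [Finset.mul_sum]
  convert h2 using 2
  rw [Finset.sum_ite_eq' S y]
  split_ifs with h
  · rfl
  · exact hc h

theorem eventually_notMem_of_finite {F : Set ℂ} (hF : F.Finite) (y : ℂ) :
    ∀ᶠ z in 𝓝[≠] y, z ∉ F := by
  have h : (F \ {y})ᶜ ∈ 𝓝 y := (hF.subset Set.sdiff_subset).isClosed.isOpen_compl.mem_nhds (by simp)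
  filter_upwards [nhdsWithin_le_nhds h, self_mem_nhdsWithin] with z hz hzy hzF
  exact hz ⟨hzF, hzy⟩

/-! ### Multiplicity-free branching from residues. -/

section Branching

set_option linter.unusedSectionVars false

variable {α : Type*} [Fintype α] [DecidableEq α]
  {V : Type*} [AddCommGroup V] [Module ℂ V] [FiniteDimensional ℂ V]
  {W : Type*} [AddCommGroup W] [Module ℂ W] [FiniteDimensional ℂ W]
  {ρ : Representation ℂ (Perm (Option α)) V} {σ : Representation ℂ (Perm α) W}

/-- The scalar by which the Jucys–Murphy element acts on copies of `σ` inside `ρ`. -/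
noncomputable def branchWeight (ρ : Representation ℂ (Perm (Option α)) V)
    (σ : Representation ℂ (Perm α) W) : ℝ :=
  (swapScalar ρ - swapScalar σ - 1) / 2

/-- A linear map intertwining the restriction of `ρ` with `σ`. -/
def IsRestrictionMap (ρ : Representation ℂ (Perm (Option α)) V)
    (σ : Representation ℂ (Perm α) W) (T : V →ₗ[ℂ] W) : Prop :=
  ∀ h v, T (ρ (permOption α h) v) = σ h (T v)

theorem IsRestrictionMap.map_groupAlgInc {T : V →ₗ[ℂ] W} (hT : IsRestrictionMap ρ σ T)
    (a : MonoidAlgebra ℂ (Perm α)) (v : V) :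
    T (ρ.asAlgebraHom (groupAlgInc a) v) = σ.asAlgebraHom a (T v) := by
  induction a using MonoidAlgebra.induction_linear with
  | zero => simp
  | add x y hx hy => simp only [map_add, LinearMap.add_apply, hx, hy]
  | single τ r =>
    rw [groupAlgInc_single, Representation.asAlgebraHom_single, Representation.asAlgebraHom_single,
      LinearMap.smul_apply, map_smul, hT]
    rfl

theorem IsRestrictionMap.map_jucysMurphy {T : V →ₗ[ℂ] W} (hT : IsRestrictionMap ρ σ T)
    (hρ : ρ.IsIrreducible) (hσ : σ.IsIrreducible) (v : V) :
    T (ρ.asAlgebraHom (jucysMurphy α) v) = (branchWeight ρ σ : ℂ) • T v := by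
  have h1 : jucysMurphy α = (1 / 2 : ℂ) • (swapSum (Option α) - groupAlgInc (swapSum α) - 1) := by
    rw [swapSum_option]
    module
  rw [h1, map_smul, map_sub, map_sub, map_one, LinearMap.smul_apply, LinearMap.sub_apply,
    LinearMap.sub_apply, asAlgebraHom_swapSum hρ, map_smul, map_sub, map_sub, hT.map_groupAlgInc,
    asAlgebraHom_swapSum hσ, branchWeight]
  simp only [LinearMap.smul_apply, Module.End.one_apply, map_smul]
  push_cast
  module

/-- `condExp Q` commutes with the group algebra of the smaller group, hence is scalar on `σ`;
`trace_coindTrans` and `trace_resolvent` give its value. -/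
theorem coind_resolvent (hσ : σ.IsIrreducible) {z : ℂ} {Q : MonoidAlgebra ℂ (Perm (Option α))}
    (hQ : Q * (algebraMap ℂ _ z - jucysMurphy α) = 1)
    (hQ' : (algebraMap ℂ _ z - jucysMurphy α) * Q = 1) :
    σ.asAlgebraHom (condExp Q)
      = ((∑ w ∈ eigenvalueFinset (coindJM σ), (algMult (coindJM σ) w : ℂ) / (z - w))
          / ((Fintype.card α + 1) * Module.finrank ℂ W)) • 1 := by
  have hc := commute_condExp hQ hQ'
  obtain ⟨c, hcE⟩ := hσ.exists_eq_smul_one (σ.asAlgebraHom (condExp Q))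
    (commute_asAlgebraHom fun g => (hc _).2)
  have hW := (isIrreducible_iff_invariant.1 hσ).1
  have hd : (Module.finrank ℂ W : ℂ) ≠ 0 := Nat.cast_ne_zero.2 Module.finrank_pos.ne'
  have htr := trace_coindTrans σ Q (fun b => (hc b).1)
  -- Left translation reverses products, so each one-sided inverse here comes from the opposite one
  -- in the group algebra.
  have h1 : coindTrans σ Q (fun b => (hc b).1) * (algebraMap ℂ _ z - coindJM σ) = 1 := by
    refine LinearMap.ext fun f => Subtype.ext ?_
    have h2 : leftTrans W Q ((leftTrans W (algebraMap ℂ _ z - jucysMurphy α)) f.1) = f.1 := by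
      rw [← Module.End.mul_apply, ← leftTrans_mul, hQ', leftTrans_one, Module.End.one_apply]
    rw [map_sub, Algebra.algebraMap_eq_smul_one, map_smul, leftTrans_one] at h2
    exact h2
  have h1' : (algebraMap ℂ _ z - coindJM σ) * coindTrans σ Q (fun b => (hc b).1) = 1 := by
    refine LinearMap.ext fun f => Subtype.ext ?_
    have h2 : (leftTrans W (algebraMap ℂ _ z - jucysMurphy α)) (leftTrans W Q f.1) = f.1 := by
      rw [← Module.End.mul_apply, ← leftTrans_mul, hQ, leftTrans_one, Module.End.one_apply]
    rw [map_sub, Algebra.algebraMap_eq_smul_one, map_smul, leftTrans_one] at h2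
    exact h2
  rw [trace_resolvent h1 h1', hcE, map_smul, LinearMap.trace_one, smul_eq_mul] at htr
  rw [hcE, htr]
  congr 1
  have hn : (Fintype.card α + 1 : ℂ) ≠ 0 := Nat.cast_add_one_ne_zero _
  field_simp

/-- The two parts of `condExp_resolvent`, read on `ρ`: the second by taking traces, the first by
applying `T`, through which the Jucys–Murphy element acts as `branchWeight ρ σ`. -/
theorem resolvent_identities (hρ : ρ.IsIrreducible) (hσ : σ.IsIrreducible) {T : V →ₗ[ℂ] W}
    (hT : IsRestrictionMap ρ σ T) (hT0 : T ≠ 0) :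
    ∃ F : Set ℂ, F.Finite ∧ ∀ z, z ∉ F → ∃ γ : ℂ,
      γ = (∑ x ∈ eigenvalueFinset (coindJM ρ), (algMult (coindJM ρ) x : ℂ) / (z - x))
        / ((Fintype.card α + 2) * Module.finrank ℂ V) ∧
      γ * (z * Module.finrank ℂ V - (Fintype.card α + 1) *
        ∑ y ∈ eigenvalueFinset (ρ.asAlgebraHom (jucysMurphy α)),
          (algMult (ρ.asAlgebraHom (jucysMurphy α)) y : ℂ) / (z - y)) = Module.finrank ℂ V ∧
      γ * (1 - 1 / (z - branchWeight ρ σ) ^ 2)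
        = (∑ w ∈ eigenvalueFinset (coindJM σ), (algMult (coindJM σ) w : ℂ) / (z - w))
          / ((Fintype.card α + 1) * Module.finrank ℂ W) := by
  obtain ⟨F₁, hF₁, h₁⟩ := exists_resolvent (jucysMurphy α)
  obtain ⟨F₂, hF₂, h₂⟩ := exists_resolvent (jucysMurphy (Option α))
  refine ⟨F₁ ∪ F₂ ∪ {(branchWeight ρ σ : ℂ)}, (hF₁.union hF₂).union (Set.finite_singleton _),
    fun z hz => ?_⟩
  simp only [Set.mem_union, Set.mem_singleton_iff, not_or] at hz
  obtain ⟨Q, hQ, hQ'⟩ := h₁ z hz.1.1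
  obtain ⟨P, hP, hP'⟩ := h₂ z hz.1.2
  obtain ⟨e1, e2⟩ := condExp_resolvent hP hP' hQ hQ'
  have hzy : z - branchWeight ρ σ ≠ 0 := sub_ne_zero.2 hz.2
  have hEP := coind_resolvent hρ hP hP'
  have hEQ := coind_resolvent hσ hQ hQ'
  rw [Fintype.card_option] at hEP
  push_cast at hEP
  rw [add_assoc, one_add_one_eq_two] at hEP
  set γ := (∑ x ∈ eigenvalueFinset (coindJM ρ), (algMult (coindJM ρ) x : ℂ) / (z - x))
        / ((Fintype.card α + 2) * Module.finrank ℂ V) with hγ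
  set c := (∑ w ∈ eigenvalueFinset (coindJM σ), (algMult (coindJM σ) w : ℂ) / (z - w))
          / ((Fintype.card α + 1) * Module.finrank ℂ W) with hc
  have hρQ : ρ.asAlgebraHom Q * (algebraMap ℂ _ z - ρ.asAlgebraHom (jucysMurphy α)) = 1 := by
    have := congrArg ρ.asAlgebraHom hQ
    rwa [map_mul, map_sub, map_one, AlgHom.commutes] at this
  have hρQ' : (algebraMap ℂ _ z - ρ.asAlgebraHom (jucysMurphy α)) * ρ.asAlgebraHom Q = 1 := by
    have := congrArg ρ.asAlgebraHom hQ'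
    rwa [map_mul, map_sub, map_one, AlgHom.commutes] at this
  refine ⟨γ, rfl, ?_, ?_⟩
  · rw [← trace_resolvent hρQ hρQ']
    have h3 := congrArg (fun a => LinearMap.trace ℂ V (ρ.asAlgebraHom a)) e2
    simp only [map_sub, map_mul, map_sum, map_one, AlgHom.commutes, hEP,
      Representation.asAlgebraHom_single_one, LinearMap.trace_one] at h3
    have h4 : ∀ o : Option α, LinearMap.trace ℂ V (ρ (swap none o) *
        (ρ.asAlgebraHom Q * γ • 1) * ρ (swap none o))
        = γ * LinearMap.trace ℂ V (ρ.asAlgebraHom Q) := by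
      intro o
      rw [LinearMap.trace_mul_cycle, ← map_mul, swap_mul_self, map_one, one_mul, mul_smul_comm,
        mul_one, map_smul, smul_eq_mul]
    simp only [h4, Finset.sum_const, Finset.card_univ, Fintype.card_option, nsmul_eq_mul,
      Algebra.algebraMap_eq_smul_one, smul_mul_assoc, one_mul, map_smul, LinearMap.trace_one,
      smul_eq_mul] at h3
    push_cast at h3
    linear_combination h3
  · obtain ⟨v, hv⟩ : ∃ v, T v ≠ 0 := by
      by_contra! h
      exact hT0 (LinearMap.ext h)
    have hTQ : ∀ v, T (ρ.asAlgebraHom Q v) = (z - branchWeight ρ σ)⁻¹ • T v := by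
      intro v
      have h5 := congrArg T (LinearMap.congr_fun hρQ' v)
      simp only [Module.End.mul_apply, LinearMap.sub_apply, Module.algebraMap_end_apply, map_sub,
        map_smul, hT.map_jucysMurphy hρ hσ, Module.End.one_apply, ← sub_smul] at h5
      rw [← h5, smul_smul, inv_mul_cancel₀ hzy, one_smul]
    have h6 := congrArg (fun a => T (ρ.asAlgebraHom a v)) e1
    simp only [hT.map_groupAlgInc, hEQ, map_mul, hEP, map_sub, map_one, Module.End.mul_apply,
      LinearMap.smul_apply, Module.End.one_apply, LinearMap.sub_apply, map_smul, hTQ] at h6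
    have h7 : (γ * (1 - 1 / (z - branchWeight ρ σ) ^ 2)) • T v = c • T v := by
      rw [← h6]
      have : 1 / (z - (branchWeight ρ σ : ℂ)) ^ 2
        = (z - branchWeight ρ σ)⁻¹ * (z - branchWeight ρ σ)⁻¹ := by
        field_simp
      rw [this]
      module
    exact smul_left_injective ℂ hv h7

/-- Eliminate γ from the two identities, multiply by (z - y)² and let z tend to the weight y. Only
the residues at y and the double pole of 1/(z - y)² survive. -/
theorem algMult_mul_algMult (hρ : ρ.IsIrreducible) (hσ : σ.IsIrreducible) {T : V →ₗ[ℂ] W}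
    (hT : IsRestrictionMap ρ σ T) (hT0 : T ≠ 0) :
    algMult (coindJM σ) (branchWeight ρ σ) *
      algMult (ρ.asAlgebraHom (jucysMurphy α)) (branchWeight ρ σ)
      = Module.finrank ℂ V * Module.finrank ℂ W := by
  obtain ⟨F, hF, h⟩ := resolvent_identities hρ hσ hT hT0
  set y : ℂ := ((branchWeight ρ σ : ℝ) : ℂ) with hy
  have hW := (isIrreducible_iff_invariant.1 hσ).1
  have hdW : (Module.finrank ℂ W : ℂ) ≠ 0 := Nat.cast_ne_zero.2 Module.finrank_pos.ne'
  have hn : (Fintype.card α + 1 : ℂ) ≠ 0 := Nat.cast_add_one_ne_zero _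
  have l1 := tendsto_residue (S := eigenvalueFinset (coindJM σ))
    (c := fun w => (algMult (coindJM σ) w : ℂ)) y
    (fun h => by simpa [mem_eigenvalueFinset] using h)
  have l2 := tendsto_residue (S := eigenvalueFinset (ρ.asAlgebraHom (jucysMurphy α)))
    (c := fun w => (algMult (ρ.asAlgebraHom (jucysMurphy α)) w : ℂ)) y
    (fun h => by simpa [mem_eigenvalueFinset] using h)
  have l3 : Tendsto (fun z : ℂ => z - y) (𝓝[≠] y) (𝓝 0) := by
    have : Tendsto (fun z : ℂ => z - y) (𝓝 y) (𝓝 (y - y)) :=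
      (continuous_id.sub continuous_const).tendsto y
    rw [sub_self] at this
    exact this.mono_left nhdsWithin_le_nhds
  have l4 : Tendsto (fun z : ℂ => z) (𝓝[≠] y) (𝓝 y) := nhdsWithin_le_nhds
  have l5 := l1.mul (((l3.mul l4).mul_const (Module.finrank ℂ V : ℂ)).sub
    (l2.const_mul (Fintype.card α + 1 : ℂ)))
  have l6 : Tendsto (fun z : ℂ => (Module.finrank ℂ V : ℂ) *
      ((Fintype.card α + 1) * Module.finrank ℂ W) * ((z - y) ^ 2 - 1)) (𝓝[≠] y)
      (𝓝 ((Module.finrank ℂ V : ℂ) * ((Fintype.card α + 1) * Module.finrank ℂ W) *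
        (0 ^ 2 - 1))) := ((l3.pow 2).sub_const 1).const_mul _
  have heq := tendsto_nhds_unique (l5.congr' ?_) l6
  · have h8 : (algMult (coindJM σ) y : ℂ) * algMult (ρ.asAlgebraHom (jucysMurphy α)) y
      = Module.finrank ℂ V * Module.finrank ℂ W := by
      apply mul_left_cancel₀ hn
      linear_combination -heq
    exact_mod_cast h8
  · filter_upwards [eventually_notMem_of_finite hF y, self_mem_nhdsWithin] with z hz hzy
    obtain ⟨γ, -, h1, h2⟩ := h z hz
    have hzy' : z - y ≠ 0 := sub_ne_zero.2 hzy
    rw [eq_div_iff (mul_ne_zero hn hdW)] at h2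
    have h3 : (1 - 1 / (z - y) ^ 2) * (z - y) ^ 2 = (z - y) ^ 2 - 1 := by
      field_simp
    rw [← h2, ← h3]
    linear_combination (1 - 1 / (z - y) ^ 2) * (z - y) ^ 2 *
      ((Fintype.card α + 1) * Module.finrank ℂ W) * h1

theorem IsRestrictionMap.surjective {T : V →ₗ[ℂ] W} (hT : IsRestrictionMap ρ σ T)
    (hσ : σ.IsIrreducible) (hT0 : T ≠ 0) : Function.Surjective T := by
  rw [← LinearMap.range_eq_top]
  refine ((isIrreducible_iff_invariant.1 hσ).2 (LinearMap.range T) ?_).resolve_left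
    (fun h => hT0 (LinearMap.range_eq_bot.1 h))
  rintro g _ ⟨v, rfl⟩
  exact ⟨_, hT g v⟩

/-- `T` kills every generalised eigenspace but that of the weight, which must therefore map onto W.
-/
theorem finrank_le_algMult_down (hρ : ρ.IsIrreducible) (hσ : σ.IsIrreducible) {T : V →ₗ[ℂ] W}
    (hT : IsRestrictionMap ρ σ T) (hT0 : T ≠ 0) :
    Module.finrank ℂ W ≤ algMult (ρ.asAlgebraHom (jucysMurphy α)) (branchWeight ρ σ) := by
  set X := ρ.asAlgebraHom (jucysMurphy α) with hX
  have hpow : ∀ (μ : ℂ) (k : ℕ) (v : V),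
      T (((X - μ • 1) ^ k) v) = ((branchWeight ρ σ : ℂ) - μ) ^ k • T v := by
    intro μ k
    induction k with
    | zero => simp
    | succ k ih =>
      intro v
      rw [pow_succ, Module.End.mul_apply, ih, LinearMap.sub_apply, map_sub,
        hT.map_jucysMurphy hρ hσ, LinearMap.smul_apply, Module.End.one_apply, map_smul]
      module
  have hmap : (X.maxGenEigenspace (branchWeight ρ σ)).map T = ⊤ := by
    rw [eq_top_iff, ← LinearMap.range_eq_top.2 (hT.surjective hσ hT0), ← Submodule.map_top,
      ← X.iSup_maxGenEigenspace_eq_top, Submodule.map_iSup]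
    refine iSup_le fun μ => ?_
    by_cases hμ : μ = branchWeight ρ σ
    · rw [hμ]
    · rintro _ ⟨v, hv, rfl⟩
      obtain ⟨k, hk⟩ := (Module.End.mem_maxGenEigenspace _ _ _).1 hv
      have h := hpow μ k v
      rw [hk, map_zero] at h
      have h0 : T v = 0 := (smul_eq_zero.1 h.symm).resolve_left
        (pow_ne_zero _ (sub_ne_zero.2 (Ne.symm hμ)))
      rw [h0]
      exact zero_mem _
  rw [algMult, ← finrank_top ℂ W, ← hmap]
  exact Submodule.finrank_map_le _ _

/-- The map to the coinduced module corresponding to a restriction map. -/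
noncomputable def toCoind (T : V →ₗ[ℂ] W) (hT : IsRestrictionMap ρ σ T) :
    V →ₗ[ℂ] Representation.coindV (permOption α) σ :=
  LinearMap.codRestrict _ (LinearMap.pi fun g => T ∘ₗ ρ g) (by
    intro v h g
    simp only [LinearMap.pi_apply, LinearMap.comp_apply, map_mul, Module.End.mul_apply]
    exact hT h _)

theorem toCoind_equivariant (T : V →ₗ[ℂ] W) (hT : IsRestrictionMap ρ σ T)
    (g : Perm (Option α)) (v : V) :
    toCoind T hT (ρ g v) = Representation.coind (permOption α) σ g (toCoind T hT v) := by
  apply Subtype.ext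
  funext k
  change T (ρ k (ρ g v)) = T (ρ (k * g) v)
  rw [map_mul, Module.End.mul_apply]

theorem map_asAlgebraHom {G : Type*} [Group G] {V₁ V₂ : Type*} [AddCommGroup V₁] [Module ℂ V₁]
    [AddCommGroup V₂] [Module ℂ V₂] {ρ₁ : Representation ℂ G V₁} {ρ₂ : Representation ℂ G V₂}
    {T : V₁ →ₗ[ℂ] V₂} (hT : ∀ g v, T (ρ₁ g v) = ρ₂ g (T v)) (a : MonoidAlgebra ℂ G) (v : V₁) :
    T (ρ₁.asAlgebraHom a v) = ρ₂.asAlgebraHom a (T v) := by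
  induction a using MonoidAlgebra.induction_linear with
  | zero => simp
  | add x y hx hy => simp only [map_add, LinearMap.add_apply, hx, hy]
  | single τ r =>
    rw [Representation.asAlgebraHom_single, Representation.asAlgebraHom_single,
      LinearMap.smul_apply, map_smul, hT]
    rfl

theorem toCoind_asAlgebraHom (T : V →ₗ[ℂ] W) (hT : IsRestrictionMap ρ σ T)
    (a : MonoidAlgebra ℂ (Perm (Option α))) (v : V) :
    toCoind T hT (ρ.asAlgebraHom a v)
      = (Representation.coind (permOption α) σ).asAlgebraHom a (toCoind T hT v) :=
  map_asAlgebraHom (toCoind_equivariant T hT) a v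

/-- Frobenius reciprocity embeds V in the coinduced module, inside the eigenspace of the weight. -/
theorem finrank_le_algMult_up (hρ : ρ.IsIrreducible) (hσ : σ.IsIrreducible) {T : V →ₗ[ℂ] W}
    (hT : IsRestrictionMap ρ σ T) (hT0 : T ≠ 0) :
    Module.finrank ℂ V ≤ algMult (coindJM σ) (branchWeight ρ σ) := by
  have hinj : Function.Injective (toCoind T hT) := by
    rw [← LinearMap.ker_eq_bot]
    refine ((isIrreducible_iff_invariant.1 hρ).2 _ ?_).resolve_right fun h => hT0 ?_
    · intro g v hv
      rw [LinearMap.mem_ker] at hv ⊢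
      rw [toCoind_equivariant, hv, map_zero]
    · refine LinearMap.ext fun v => ?_
      have h1 : v ∈ LinearMap.ker (toCoind T hT) := h ▸ Submodule.mem_top
      have h2 := congrFun (congrArg Subtype.val (LinearMap.mem_ker.1 h1)) 1
      have h3 : T (ρ 1 v) = 0 := h2
      rwa [map_one] at h3
  have hmem : ∀ v, toCoind T hT v ∈ (coindJM σ).maxGenEigenspace (branchWeight ρ σ) := by
    intro v
    refine Module.End.eigenspace_le_maxGenEigenspace (Module.End.mem_eigenspace_iff.2 ?_)
    rw [coindJM_eq σ hσ]
    change (1 / 2 : ℂ) • ((Representation.coind (permOption α) σ).asAlgebraHom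
      (swapSum (Option α)) (toCoind T hT v) - ((swapScalar σ + 1 : ℝ) : ℂ) • toCoind T hT v) = _
    rw [← toCoind_asAlgebraHom, asAlgebraHom_swapSum hρ, LinearMap.smul_apply,
      Module.End.one_apply, map_smul, branchWeight]
    push_cast
    module
  rw [algMult]
  exact LinearMap.finrank_le_finrank_of_injective
    (f := (toCoind T hT).codRestrict _ hmem) (fun a b hab => hinj (congrArg Subtype.val hab))

/-- The branching rule is multiplicity free, and weights separate the constituents. -/
theorem algMult_eq_finrank (hρ : ρ.IsIrreducible) (hσ : σ.IsIrreducible) {T : V →ₗ[ℂ] W}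
    (hT : IsRestrictionMap ρ σ T) (hT0 : T ≠ 0) :
    algMult (coindJM σ) (branchWeight ρ σ) = Module.finrank ℂ V ∧
      algMult (ρ.asAlgebraHom (jucysMurphy α)) (branchWeight ρ σ) = Module.finrank ℂ W := by
  have h1 := algMult_mul_algMult hρ hσ hT hT0
  have h2 := finrank_le_algMult_up hρ hσ hT hT0
  have h3 := finrank_le_algMult_down hρ hσ hT hT0
  have hV := (isIrreducible_iff_invariant.1 hρ).1
  have hW := (isIrreducible_iff_invariant.1 hσ).1
  have hdV : 0 < Module.finrank ℂ V := Module.finrank_pos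
  have hdW : 0 < Module.finrank ℂ W := Module.finrank_pos
  -- Two positive lower bounds whose product is attained must both be equalities.
  constructor <;> nlinarith

end Branching

/-! ### Every eigenvalue comes from an irreducible constituent. -/

section Existence

variable {α : Type} [Fintype α] [DecidableEq α]

/-- Take an irreducible subrepresentation of the generalised eigenspace; evaluation at 1 is a
nonzero restriction map on it. -/
theorem exists_up {W : Type} [AddCommGroup W] [Module ℂ W] [FiniteDimensional ℂ W]
    {σ : Representation ℂ (Perm α) W} (hσ : σ.IsIrreducible) {w : ℂ}
    (hw : algMult (coindJM σ) w ≠ 0) :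
    ∃ (V : Type) (_ : AddCommGroup V) (_ : Module ℂ V) (_ : FiniteDimensional ℂ V)
      (ρ : Representation ℂ (Perm (Option α)) V), ρ.IsIrreducible ∧
      w = (branchWeight ρ σ : ℝ) ∧ algMult (coindJM σ) w = Module.finrank ℂ V := by
  set κ := Representation.coind (permOption α) σ with hκ
  obtain ⟨U, hUle, hU⟩ := exists_irreducible_le (ρ := κ) ((coindJM σ).maxGenEigenspace w)
    (by rwa [algMult, Ne, Submodule.finrank_eq_zero] at hw)
    (fun g => (coindJM σ).mapsTo_maxGenEigenspace_of_comm (commute_coindJM σ hσ g).symm w)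
  let T : U.toSubmodule →ₗ[ℂ] W := LinearMap.proj (1 : Perm (Option α)) ∘ₗ
    (Representation.coindV (permOption α) σ).subtype ∘ₗ U.toSubmodule.subtype
  have hT : IsRestrictionMap (V := U.toSubmodule) U.toRepresentation σ T := by
    intro h f
    have h1 := f.1.2 h 1
    change f.1.1 (1 * permOption α h) = σ h (f.1.1 1)
    rwa [one_mul, ← mul_one (permOption α h)]
  have hnt := (isIrreducible_iff_invariant.1 hU).1
  obtain ⟨f, hf⟩ := exists_ne (0 : U.toSubmodule)
  have hT0 : T ≠ 0 := by
    intro h0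
    apply hf
    apply Subtype.ext
    apply Subtype.ext
    funext g
    have h1 : T (U.toRepresentation g f) = 0 := by rw [h0]; rfl
    have h2 : f.1.1 (1 * g) = 0 := h1
    rwa [one_mul] at h2
  have hact : coindJM σ f.1 = ((branchWeight (V := U.toSubmodule) U.toRepresentation σ : ℝ) : ℂ) • f.1 := by
    have h1 : κ.asAlgebraHom (swapSum (Option α)) f.1
        = ((swapScalar (V := U.toSubmodule) U.toRepresentation : ℝ) : ℂ) • f.1 := by
      have h2 := map_asAlgebraHom (ρ₁ := U.toRepresentation) (ρ₂ := κ)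
        (T := U.toSubmodule.subtype) (fun g v => rfl) (swapSum (Option α)) f
      rw [asAlgebraHom_swapSum hU] at h2
      exact h2.symm
    rw [coindJM_eq σ hσ]
    change (1 / 2 : ℂ) • (κ.asAlgebraHom (swapSum (Option α)) f.1
      - ((swapScalar σ + 1 : ℝ) : ℂ) • f.1) = _
    rw [h1, branchWeight]
    push_cast
    module
  have hw' : w = (branchWeight (V := U.toSubmodule) U.toRepresentation σ : ℝ) := by
    obtain ⟨k, hk⟩ := (Module.End.mem_maxGenEigenspace _ _ _).1 (hUle f.2)
    have h3 : ∀ j : ℕ, ((coindJM σ - w • 1) ^ j) f.1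
        = (((branchWeight (V := U.toSubmodule) U.toRepresentation σ : ℝ) : ℂ) - w) ^ j • f.1 := by
      intro j
      induction j with
      | zero => simp
      | succ j ih =>
        rw [pow_succ', Module.End.mul_apply, ih, map_smul, LinearMap.sub_apply, hact,
          LinearMap.smul_apply, Module.End.one_apply]
        module
    rw [h3] at hk
    rcases smul_eq_zero.1 hk with h | h
    · exact (sub_eq_zero.1 (eq_zero_of_pow_eq_zero h)).symm
    · exact absurd (Subtype.ext h) hf
  refine ⟨U.toSubmodule, inferInstance, inferInstance, inferInstance, U.toRepresentation, hU,
    hw', ?_⟩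
  rw [hw']
  exact (algMult_eq_finrank hU hσ hT hT0).1

/-- The range of `X - y` is proper and stable under the smaller group; on an irreducible quotient
that kills it, the Jucys–Murphy element acts as y. -/
theorem exists_down {V : Type} [AddCommGroup V] [Module ℂ V] [FiniteDimensional ℂ V]
    {ρ : Representation ℂ (Perm (Option α)) V} (hρ : ρ.IsIrreducible) {y : ℂ}
    (hy : algMult (ρ.asAlgebraHom (jucysMurphy α)) y ≠ 0) :
    ∃ (W : Type) (_ : AddCommGroup W) (_ : Module ℂ W) (_ : FiniteDimensional ℂ W)
      (σ : Representation ℂ (Perm α) W) (T : V →ₗ[ℂ] W), σ.IsIrreducible ∧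
      IsRestrictionMap ρ σ T ∧ T ≠ 0 ∧ y = (branchWeight ρ σ : ℝ) := by
  set X := ρ.asAlgebraHom (jucysMurphy α) with hX
  obtain ⟨v, hv0, hv⟩ := exists_eigenvector hy
  have hN : LinearMap.range (X - y • 1) ≠ ⊤ := by
    intro h
    have hinj := (LinearMap.injective_iff_surjective).2 (LinearMap.range_eq_top.1 h)
    apply hv0
    apply hinj
    simp [hv]
  have hinv : ∀ g, ∀ u ∈ LinearMap.range (X - y • 1),
      (ρ.comp (permOption α)) g u ∈ LinearMap.range (X - y • 1) := by
    rintro g _ ⟨u, rfl⟩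
    refine ⟨ρ (permOption α g) u, ?_⟩
    have h1 : Commute (ρ (permOption α g)) X := by
      have := (commute_single_jucysMurphy g).map ρ.asAlgebraHom
      rwa [Representation.asAlgebraHom_single_one] at this
    have h2 := LinearMap.congr_fun h1 u
    simp only [Module.End.mul_apply] at h2
    simp [h2]
  obtain ⟨U, σ, hNU, hU, hσ, hq⟩ := exists_irreducible_quotient (ρ := ρ.comp (permOption α))
    _ hN hinv
  have hT : IsRestrictionMap ρ σ U.mkQ := fun h v => (hq h v).symm
  have hT0 : U.mkQ ≠ 0 := fun h => hU (by rw [← U.ker_mkQ, h, LinearMap.ker_zero])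
  refine ⟨V ⧸ U, inferInstance, inferInstance, inferInstance, σ, U.mkQ, hσ, hT, hT0, ?_⟩
  obtain ⟨u, hu⟩ : ∃ u, U.mkQ u ≠ 0 := by
    by_contra! h
    exact hT0 (LinearMap.ext h)
  have h1 : U.mkQ ((X - y • 1) u) = 0 := by
    rw [Submodule.mkQ_apply, Submodule.Quotient.mk_eq_zero]
    exact hNU ⟨u, rfl⟩
  rw [LinearMap.sub_apply, map_sub, hT.map_jucysMurphy hρ hσ, LinearMap.smul_apply,
    Module.End.one_apply, map_smul, ← sub_smul] at h1
  exact (sub_eq_zero.1 ((smul_eq_zero.1 h1).resolve_right hu)).symm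

end Existence

theorem sum_algMult {V : Type*} [AddCommGroup V] [Module ℂ V] [FiniteDimensional ℂ V]
    (T : Module.End ℂ V) : ∑ μ ∈ eigenvalueFinset T, algMult T μ = Module.finrank ℂ V := by
  have hmaps : ∀ μ, Set.MapsTo (1 : Module.End ℂ V) (T.maxGenEigenspace μ)
      (T.maxGenEigenspace μ) := fun μ v hv => hv
  have h := LinearMap.trace_eq_sum_trace_restrict' (isInternal_maxGenEigenspace T)
    (finite_maxGenEigenspace_ne_bot T) hmaps
  have h1 : ∀ μ, (1 : Module.End ℂ V).restrict (hmaps μ) = 1 := fun μ => rfl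
  simp only [h1, LinearMap.trace_one] at h
  exact_mod_cast h.symm

/-! ### Interlacing weights from a reciprocal pair of rational functions. -/

/-- Two interlacing sets of reals with positive weights: `p` sums to one, `a` sums to `n`, and
`∑ p x / (z - x)` is the inverse of `z - ∑ a y / (z - y)`. -/
structure InterlacingWeights (n : ℝ) (X Y : Finset ℝ) (p a : ℝ → ℝ) : Prop where
  p_pos : ∀ x ∈ X, 0 < p x
  a_pos : ∀ y ∈ Y, 0 < a y
  sum_p : ∑ x ∈ X, p x = 1
  sum_a : ∑ y ∈ Y, a y = n
  one_le_abs_sub : ∀ x ∈ X, ∀ y ∈ Y, 1 ≤ |x - y|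
  sum_div_eq_zero : ∀ y ∈ Y, ∑ x ∈ X, p x / (y - x) = 0
  sum_div_sq : ∀ y ∈ Y, ∑ x ∈ X, p x / (y - x) ^ 2 = 1 / a y
  eq_sum_div : ∀ x ∈ X, x = ∑ y ∈ Y, a y / (x - y)

section Identities

variable {X Y : Finset ℝ} {p a : ℝ → ℝ} {F : Set ℂ}

theorem tendsto_residue_real {X : Finset ℝ} {p : ℝ → ℝ} (y : ℝ) (hy : y ∉ X → p y = 0) :
    Tendsto (fun z : ℂ => (z - y) * ∑ x ∈ X, (p x : ℂ) / (z - x)) (𝓝[≠] (y : ℂ))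
      (𝓝 (p y : ℂ)) := by
  have h := tendsto_residue (S := X.map ⟨Complex.ofReal, Complex.ofReal_injective⟩)
    (c := fun w => (p w.re : ℂ)) (y : ℂ) (fun h => by
      have : y ∉ X := fun h' => h (Finset.mem_map.2 ⟨y, h', rfl⟩)
      simp [hy this])
  simpa only [Finset.sum_map, Function.Embedding.coeFn_mk, Complex.ofReal_re] using h

theorem continuousAt_sum_div {X : Finset ℝ} {p : ℝ → ℝ} {y : ℝ} (hy : y ∉ X) :
    ContinuousAt (fun z : ℂ => ∑ x ∈ X, (p x : ℂ) / (z - x)) y := by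
  refine tendsto_finsetSum X fun x hx => ?_
  have : (y : ℂ) - x ≠ 0 := by
    rw [sub_ne_zero, Complex.ofReal_injective.ne_iff]
    rintro rfl
    exact hy hx
  have h2 : ContinuousAt (fun z : ℂ => (p x : ℂ) / (z - x)) y := by
    fun_prop (disch := assumption)
  exact h2

theorem tendsto_sub_nhdsNE (y : ℂ) : Tendsto (fun z : ℂ => z - y) (𝓝[≠] y) (𝓝 0) := by
  have : Tendsto (fun z : ℂ => z - y) (𝓝 y) (𝓝 (y - y)) :=
    (continuous_id.sub continuous_const).tendsto y
  rw [sub_self] at this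
  exact this.mono_left nhdsWithin_le_nhds

/-- Write g and h for the two factors in `hgh`. Since gh = 1, poles of h are simple zeros of g and
poles of g are zeros of h; the derivative of g at y gives `sum_div_sq`. Separation by 1 comes from
`hP`. -/
theorem interlacingWeights_of_identities {n : ℝ} (hF : F.Finite)
    (hp : ∀ x ∈ X, 0 < p x) (hp0 : ∀ x, x ∉ X → p x = 0)
    (ha : ∀ y ∈ Y, 0 < a y) (ha0 : ∀ y, y ∉ Y → a y = 0)
    (hsp : ∑ x ∈ X, p x = 1) (hsa : ∑ y ∈ Y, a y = n)
    (hgh : ∀ z, z ∉ F → (∑ x ∈ X, (p x : ℂ) / (z - x)) *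
      (z - ∑ y ∈ Y, (a y : ℂ) / (z - y)) = 1)
    (hP : ∀ y ∈ Y, ∀ x ∈ X, x ≠ y → 0 ≤ p x * (1 - 1 / (x - y) ^ 2)) :
    InterlacingWeights n X Y p a := by
  have hres : ∀ y : ℝ, Tendsto (fun z : ℂ => (z - y) * (z - ∑ y ∈ Y, (a y : ℂ) / (z - y)))
      (𝓝[≠] (y : ℂ)) (𝓝 (-a y : ℂ)) := by
    intro y
    have l1 : Tendsto (fun z : ℂ => z) (𝓝[≠] (y : ℂ)) (𝓝 (y : ℂ)) := nhdsWithin_le_nhds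
    have l2 := ((tendsto_sub_nhdsNE y).mul l1).sub (tendsto_residue_real y (ha0 y))
    simpa only [mul_sub, zero_mul, zero_sub] using l2
  have hYX : ∀ y ∈ Y, y ∉ X := by
    intro y hy hyX
    have l1 := (tendsto_residue_real y (hp0 y)).mul (hres y)
    have l2 := (tendsto_sub_nhdsNE y).mul (tendsto_sub_nhdsNE (y : ℂ))
    have h := tendsto_nhds_unique (l1.congr' ?_) l2
    · have h' : p y * (-a y) = 0 := by
        have : (p y : ℂ) * (-a y) = 0 := by simpa using h
        exact_mod_cast this
      have := mul_pos (hp y hyX) (ha y hy)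
      linarith
    · filter_upwards [eventually_notMem_of_finite hF (y : ℂ)] with z hz
      linear_combination (z - y) * (z - y) * hgh z hz
  have hne : ∀ y ∈ Y, ∀ x ∈ X, (y : ℂ) - x ≠ 0 := by
    intro y hy x hx
    rw [sub_ne_zero, Complex.ofReal_injective.ne_iff]
    rintro rfl
    exact hYX _ hy hx
  have hzero : ∀ y ∈ Y, ∑ x ∈ X, (p x : ℂ) / (y - x) = 0 := by
    intro y hy
    have l1 := ((continuousAt_sum_div (p := p) (hYX y hy)).tendsto.mono_left
      nhdsWithin_le_nhds).mul (hres y)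
    have h := tendsto_nhds_unique (l1.congr' ?_) (tendsto_sub_nhdsNE (y : ℂ))
    · refine (mul_eq_zero.1 h).resolve_right ?_
      exact neg_ne_zero.2 (Complex.ofReal_ne_zero.2 (ha y hy).ne')
    · filter_upwards [eventually_notMem_of_finite hF (y : ℂ)] with z hz
      linear_combination (z - y) * hgh z hz
  refine ⟨hp, ha, hsp, hsa, ?_, ?_, ?_, ?_⟩
  · intro x hx y hy
    have hxy : x ≠ y := by
      rintro rfl
      exact hYX _ hy hx
    have h1 := nonneg_of_mul_nonneg_right (hP y hy x hx hxy) (hp x hx)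
    have h2 : 0 < (x - y) ^ 2 := by positivity
    have h3 : 1 ≤ (x - y) ^ 2 := by
      have : 1 / (x - y) ^ 2 ≤ 1 := by linarith
      rwa [div_le_one h2] at this
    exact one_le_sq_iff_one_le_abs _ |>.1 h3
  · intro y hy
    exact_mod_cast hzero y hy
  · intro y hy
    have l1 : Tendsto (fun z : ℂ => -∑ x ∈ X, (p x / (y - x) : ℂ) / (z - x)) (𝓝[≠] (y : ℂ))
        (𝓝 (-∑ x ∈ X, (p x / (y - x) : ℂ) / (y - x))) := by
      refine (Tendsto.mono_left ?_ nhdsWithin_le_nhds).neg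
      have := (continuousAt_sum_div (p := fun x => p x / (y - x)) (hYX y hy)).tendsto
      simpa only [Complex.ofReal_div, Complex.ofReal_sub] using this
    have l2 := l1.mul (hres y)
    have h := tendsto_nhds_unique (l2.congr' ?_) (tendsto_const_nhds (x := (1 : ℂ)))
    · have hay := (ha y hy).ne'
      have h' : (∑ x ∈ X, p x / (y - x) ^ 2) * a y = 1 := by
        have h2 : ∀ x ∈ X, (p x / (y - x) : ℂ) / (y - x) = p x / (y - x) ^ 2 := by
          intro x _
          rw [div_div, ← pow_two]
        rw [Finset.sum_congr rfl h2, neg_mul_neg] at h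
        exact_mod_cast h
      rw [eq_div_iff hay, h']
    · filter_upwards [eventually_notMem_of_finite hF (y : ℂ), self_mem_nhdsWithin,
        eventually_notMem_of_finite (X.finite_toSet.image Complex.ofReal) (y : ℂ)] with z hz hzy hzX
      have hzy' : z - y ≠ 0 := sub_ne_zero.2 hzy
      -- Subtracting g(y) = 0 turns g(z)/(z - y) into a sum regular at y.
      have hsum : -∑ x ∈ X, (p x / (y - x) : ℂ) / (z - x)
          = (∑ x ∈ X, (p x : ℂ) / (z - x)) / (z - y) := by
        rw [← sub_zero (∑ x ∈ X, (p x : ℂ) / (z - x)), ← hzero y hy, ← Finset.sum_sub_distrib,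
          ← Finset.sum_neg_distrib, Finset.sum_div]
        refine Finset.sum_congr rfl fun x hx => ?_
        have h1 := hne y hy x hx
        have h2 : z - x ≠ 0 := sub_ne_zero.2 fun h => hzX ⟨x, hx, h.symm⟩
        field_simp
        ring
      rw [hsum, ← hgh z hz]
      field_simp
  · intro x hx
    have hxY : x ∉ Y := fun h => hYX x h hx
    have l1 : Tendsto (fun z : ℂ => z - ∑ y ∈ Y, (a y : ℂ) / (z - y)) (𝓝[≠] (x : ℂ))
        (𝓝 (x - ∑ y ∈ Y, (a y : ℂ) / (x - y))) :=
      (continuousAt_id.sub (continuousAt_sum_div hxY)).tendsto.mono_left nhdsWithin_le_nhds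
    have l2 := (tendsto_residue_real x (hp0 x)).mul l1
    have h := tendsto_nhds_unique (l2.congr' ?_) (tendsto_sub_nhdsNE (x : ℂ))
    · have h1 := (mul_eq_zero.1 h).resolve_left (Complex.ofReal_ne_zero.2 (hp x hx).ne')
      have h2 := sub_eq_zero.1 h1
      exact_mod_cast h2
    · filter_upwards [eventually_notMem_of_finite hF (x : ℂ)] with z hz
      linear_combination (z - x) * hgh z hz

end Identities

theorem sum_image_re {S : Finset ℂ} (hS : ∀ w ∈ S, ∃ r : ℝ, w = r) {M : Type*} [AddCommMonoid M]
    (f : ℂ → M) : ∑ x ∈ S.image Complex.re, f (x : ℂ) = ∑ w ∈ S, f w := by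
  have h1 : ∀ w ∈ S, ((w.re : ℝ) : ℂ) = w := by
    intro w hw
    obtain ⟨r, rfl⟩ := hS w hw
    simp
  rw [Finset.sum_image]
  · exact Finset.sum_congr rfl fun w hw => by rw [h1 w hw]
  · intro w hw w' hw' h
    rw [← h1 w hw, ← h1 w' hw', h]

theorem mem_image_re {S : Finset ℂ} (hS : ∀ w ∈ S, ∃ r : ℝ, w = r) {x : ℝ} :
    x ∈ S.image Complex.re ↔ (x : ℂ) ∈ S := by
  rw [Finset.mem_image]
  constructor
  · rintro ⟨w, hw, rfl⟩
    obtain ⟨r, rfl⟩ := hS w hw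
    simpa using hw
  · intro h
    exact ⟨x, h, Complex.ofReal_re x⟩

/-- The degrees of the irreducible representations at distance two from `ρ` in the branching
graph. -/
theorem exists_interlacingWeights {α : Type} [Fintype α] [DecidableEq α] {V : Type}
    [AddCommGroup V] [Module ℂ V] [FiniteDimensional ℂ V]
    {ρ : Representation ℂ (Perm (Option α)) V} (hρ : ρ.IsIrreducible) :
    ∃ (X Y : Finset ℝ) (p a : ℝ → ℝ), InterlacingWeights (Fintype.card α + 1) X Y p a ∧
      ∀ x ∈ X, ∀ y ∈ Y, 1 < |x - y| →
        ∃ (V' : Type) (_ : AddCommGroup V') (_ : Module ℂ V') (_ : FiniteDimensional ℂ V')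
          (ρ' : Representation ℂ (Perm (Option α)) V'), ρ'.IsIrreducible ∧
          (Module.finrank ℂ V' : ℝ)
            = a y * (p x * (1 - 1 / (x - y) ^ 2)) * Module.finrank ℂ V := by
  have hVn := (isIrreducible_iff_invariant.1 hρ).1
  have hd : (0 : ℝ) < Module.finrank ℂ V := Nat.cast_pos.2 Module.finrank_pos
  set d := Module.finrank ℂ V with hd_def
  have hn : (0 : ℝ) < Fintype.card α + 1 := by positivity
  have hn2 : (0 : ℝ) < Fintype.card α + 2 := by positivity
  set J := ρ.asAlgebraHom (jucysMurphy α) with hJ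
  have hSX : ∀ w ∈ eigenvalueFinset (coindJM ρ), ∃ r : ℝ, w = r := by
    intro w hw
    obtain ⟨_, _, _, _, ρ', -, h, -⟩ := exists_up hρ (mem_eigenvalueFinset.1 hw)
    exact ⟨_, h⟩
  have hSY : ∀ w ∈ eigenvalueFinset J, ∃ r : ℝ, w = r := by
    intro w hw
    obtain ⟨_, _, _, _, σ, T, -, -, -, h⟩ := exists_down hρ (mem_eigenvalueFinset.1 hw)
    exact ⟨_, h⟩
  set X := (eigenvalueFinset (coindJM ρ)).image Complex.re with hX
  set Y := (eigenvalueFinset J).image Complex.re with hY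
  set p : ℝ → ℝ := fun x => algMult (coindJM ρ) (x : ℂ) / ((Fintype.card α + 2) * d) with hp
  set a : ℝ → ℝ := fun y => (Fintype.card α + 1) * algMult J (y : ℂ) / d with ha
  have hpX : ∀ x, x ∉ X → p x = 0 := by
    intro x hx
    rw [hX, mem_image_re hSX, mem_eigenvalueFinset, not_not] at hx
    simp [hp, hx]
  have haY : ∀ y, y ∉ Y → a y = 0 := by
    intro y hy
    rw [hY, mem_image_re hSY, mem_eigenvalueFinset, not_not] at hy
    simp [ha, hy]
  have hppos : ∀ x ∈ X, 0 < p x := by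
    intro x hx
    rw [hX, mem_image_re hSX, mem_eigenvalueFinset] at hx
    have : (0 : ℝ) < algMult (coindJM ρ) (x : ℂ) := Nat.cast_pos.2 (Nat.pos_of_ne_zero hx)
    simp only [hp]
    positivity
  have hapos : ∀ y ∈ Y, 0 < a y := by
    intro y hy
    rw [hY, mem_image_re hSY, mem_eigenvalueFinset] at hy
    have : (0 : ℝ) < algMult J (y : ℂ) := Nat.cast_pos.2 (Nat.pos_of_ne_zero hy)
    simp only [ha]
    positivity
  have hsumX : ∑ x ∈ X, p x = 1 := by
    have h1 : ∑ x ∈ X, algMult (coindJM ρ) (x : ℂ)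
        = Module.finrank ℂ (Representation.coindV (permOption (Option α)) ρ) := by
      rw [hX, sum_image_re hSX (algMult (coindJM ρ)), sum_algMult]
    have h2 := finrank_coindV ρ
    rw [← h1, Fintype.card_option] at h2
    have h3 : (∑ x ∈ X, (algMult (coindJM ρ) (x : ℂ) : ℝ)) = (Fintype.card α + 2) * d := by
      have h4 : ((∑ x ∈ X, algMult (coindJM ρ) (x : ℂ) : ℕ) : ℂ)
          = (((Fintype.card α + 1 + 1) * d : ℕ) : ℂ) := by
        rw [h2]; push_cast; ring
      have h5 := Nat.cast_injective h4
      have h6 := congrArg (Nat.cast (R := ℝ)) h5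
      push_cast at h6
      rw [h6]; ring
    simp only [hp]
    rw [← Finset.sum_div, h3, div_self (by positivity)]
  have hsumY : ∑ y ∈ Y, a y = Fintype.card α + 1 := by
    have h1 : ∑ y ∈ Y, algMult J (y : ℂ) = d := by
      rw [hY, sum_image_re hSY (algMult J), sum_algMult]
    have h2 : ∑ y ∈ Y, (algMult J (y : ℂ) : ℝ) = d := by exact_mod_cast h1
    simp only [ha]
    rw [← Finset.sum_div, ← Finset.mul_sum, h2, mul_div_assoc, div_self hd.ne', mul_one]
  have hdc : (d : ℂ) ≠ 0 := by exact_mod_cast hd.ne'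
  have hnc : (Fintype.card α + 1 : ℂ) ≠ 0 := by exact_mod_cast hn.ne'
  have hn2c : (Fintype.card α + 2 : ℂ) ≠ 0 := by exact_mod_cast hn2.ne'
  have hg : ∀ z : ℂ, ∑ x ∈ X, (p x : ℂ) / (z - x)
      = (∑ x ∈ eigenvalueFinset (coindJM ρ), (algMult (coindJM ρ) x : ℂ) / (z - x))
        / ((Fintype.card α + 2) * d) := by
    intro z
    rw [← sum_image_re hSX (fun x => (algMult (coindJM ρ) x : ℂ) / (z - x)), Finset.sum_div]
    refine Finset.sum_congr rfl fun x _ => ?_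
    simp only [hp]
    push_cast
    ring
  have hh : ∀ z : ℂ, z - ∑ y ∈ Y, (a y : ℂ) / (z - y)
      = (z * d - (Fintype.card α + 1) * ∑ y ∈ eigenvalueFinset J, (algMult J y : ℂ) / (z - y))
        / d := by
    intro z
    rw [← sum_image_re hSY (fun x => (algMult J x : ℂ) / (z - x)), sub_div, mul_div_assoc z,
      div_self hdc, mul_one, Finset.mul_sum, Finset.sum_div]
    congr 1
    refine Finset.sum_congr rfl fun x _ => ?_
    simp only [ha]
    push_cast
    ring
  have key : ∀ y ∈ Y, (∃ F : Set ℂ, F.Finite ∧ ∀ z, z ∉ F → (∑ x ∈ X, (p x : ℂ) / (z - x)) *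
      (z - ∑ y ∈ Y, (a y : ℂ) / (z - y)) = 1) ∧ ∀ x ∈ X, x ≠ y →
        (0 ≤ p x * (1 - 1 / (x - y) ^ 2) ∧ (1 < |x - y| →
        ∃ (V' : Type) (_ : AddCommGroup V') (_ : Module ℂ V') (_ : FiniteDimensional ℂ V')
          (ρ' : Representation ℂ (Perm (Option α)) V'), ρ'.IsIrreducible ∧
          (Module.finrank ℂ V' : ℝ) = a y * (p x * (1 - 1 / (x - y) ^ 2)) * d)) := by
    intro y hy
    obtain ⟨W, _, _, _, σ, T, hσ, hT, hT0, hyw⟩ :=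
      exists_down hρ (mem_eigenvalueFinset.1 ((mem_image_re hSY).1 hy))
    obtain ⟨F, hF, hFz⟩ := resolvent_identities hρ hσ hT hT0
    have hyw' : y = branchWeight ρ σ := by exact_mod_cast hyw
    have hWn := (isIrreducible_iff_invariant.1 hσ).1
    have hdW : (0 : ℝ) < Module.finrank ℂ W := Nat.cast_pos.2 Module.finrank_pos
    set dW := Module.finrank ℂ W with hdW_def
    have hvy : algMult J (y : ℂ) = dW := by
      rw [hyw]
      exact (algMult_eq_finrank hρ hσ hT hT0).2
    refine ⟨⟨F, hF, fun z hz => ?_⟩, fun x hx hxy => ?_⟩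
    · obtain ⟨γ, h1, h2, -⟩ := hFz z hz
      rw [hg, hh, ← h1, ← mul_div_assoc, div_eq_one_iff_eq hdc]
      exact h2
    -- Compare residues at x in the identity linking `ρ` with `σ`. The right side is a multiplicity,
    -- hence nonnegative; when it is positive, x is a weight above `σ` too and `exists_up` applies.
    · have hPx : p x * (1 - 1 / (x - y) ^ 2)
          = algMult (coindJM σ) (x : ℂ) / ((Fintype.card α + 1) * dW) := by
        have l1 := tendsto_residue (S := eigenvalueFinset (coindJM σ))
          (c := fun w => (algMult (coindJM σ) w : ℂ)) (x : ℂ)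
          (fun h => by simpa [mem_eigenvalueFinset] using h)
        have l1' := l1.div_const ((Fintype.card α + 1 : ℂ) * dW)
        have hxyc : (x : ℂ) - y ≠ 0 := by
          rw [sub_ne_zero, Complex.ofReal_injective.ne_iff]
          exact hxy
        have l2 : Tendsto (fun z : ℂ => 1 - 1 / (z - y) ^ 2) (𝓝[≠] (x : ℂ))
            (𝓝 (1 - 1 / ((x : ℂ) - y) ^ 2)) := by
          have : ContinuousAt (fun z : ℂ => 1 - 1 / (z - y) ^ 2) x := by
            have : ((x : ℂ) - y) ^ 2 ≠ 0 := pow_ne_zero _ hxyc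
            fun_prop (disch := assumption)
          exact this.tendsto.mono_left nhdsWithin_le_nhds
        have l3 := (tendsto_residue_real x (hpX x)).mul l2
        have h := tendsto_nhds_unique (l3.congr' ?_) l1'
        · apply Complex.ofReal_injective
          push_cast
          exact h
        · filter_upwards [eventually_notMem_of_finite hF (x : ℂ)] with z hz
          obtain ⟨γ, h1, -, h3⟩ := hFz z hz
          rw [hg, ← h1, hyw', mul_assoc, h3]
          ring
      refine ⟨by rw [hPx]; positivity, fun hlt => ?_⟩
      have hpos : 0 < p x * (1 - 1 / (x - y) ^ 2) := by
        refine mul_pos (hppos x hx) ?_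
        have h1 : 1 < (x - y) ^ 2 := (one_lt_sq_iff_one_lt_abs _).2 hlt
        have h2 : 1 / (x - y) ^ 2 < 1 := by rwa [div_lt_one (by linarith)]
        linarith
      have hne : algMult (coindJM σ) (x : ℂ) ≠ 0 := by
        intro h0
        rw [hPx, h0] at hpos
        simp at hpos
      obtain ⟨V', i1, i2, i3, ρ', hρ', -, hfin⟩ := exists_up hσ hne
      refine ⟨V', i1, i2, i3, ρ', hρ', ?_⟩
      rw [← hfin, hPx]
      simp only [ha, hvy]
      field_simp
  obtain ⟨y₀, hy₀⟩ : Y.Nonempty := by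
    rw [Finset.nonempty_iff_ne_empty]
    intro h
    rw [h] at hsumY
    simp at hsumY
    linarith
  obtain ⟨F, hF, hgh⟩ := (key y₀ hy₀).1
  have hiw : InterlacingWeights (Fintype.card α + 1) X Y p a :=
    interlacingWeights_of_identities hF hppos hpX hapos haY hsumX hsumY hgh
      (fun y hy x hx hxy => ((key y hy).2 x hx hxy).1)
  refine ⟨X, Y, p, a, hiw, fun x hx y hy hlt => ((key y hy).2 x hx ?_).2 hlt⟩
  rintro rfl
  simp at hlt
  linarith

end

/-! ### Elementary inequalities and the geometry of interlacing sets. -/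

open Polynomial in
/-- For `y ≠ y'` and nonzero `A`, an equation `A (1 - 1/(x-y)²) = B (1 - 1/(x-y')²)` has at most
four solutions. -/
theorem card_le_four_of_proportional {s : Finset ℝ} {y y' A B : ℝ} (hy : y ≠ y') (hA : A ≠ 0)
    (hs : ∀ x ∈ s, x ≠ y ∧ x ≠ y' ∧ A * (1 - 1 / (x - y) ^ 2) = B * (1 - 1 / (x - y') ^ 2)) :
    s.card ≤ 4 := by
  set q : ℝ[X] := C A * (((X - C y) ^ 2 - 1) * (X - C y') ^ 2)
    - C B * (((X - C y') ^ 2 - 1) * (X - C y) ^ 2) with hq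
  have hq0 : q ≠ 0 := by
    intro h
    have h1 := congrArg (eval y) h
    simp only [hq, eval_sub, eval_mul, eval_C, eval_pow, eval_X, eval_one, eval_zero, sub_self]
      at h1
    have h2 : A * (y - y') ^ 2 = 0 := by linear_combination -h1
    rcases mul_eq_zero.1 h2 with h3 | h3
    · exact hA h3
    · exact hy (sub_eq_zero.1 (pow_eq_zero_iff two_ne_zero |>.1 h3))
  have hdeg : q.natDegree ≤ 4 := by
    rw [hq]
    compute_degree
  refine le_trans ?_ (le_trans (card_roots' q) hdeg)
  have hsub : s ⊆ q.roots.toFinset := by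
    intro x hx
    obtain ⟨h1, h2, h3⟩ := hs x hx
    rw [Multiset.mem_toFinset, mem_roots hq0, IsRoot.def]
    simp only [hq, eval_sub, eval_mul, eval_C, eval_pow, eval_X, eval_one]
    have h1' := sub_ne_zero.2 h1
    have h2' := sub_ne_zero.2 h2
    have e1 : (x - y) ^ 2 - 1 = (1 - 1 / (x - y) ^ 2) * (x - y) ^ 2 := by field_simp
    have e2 : (x - y') ^ 2 - 1 = (1 - 1 / (x - y') ^ 2) * (x - y') ^ 2 := by field_simp
    rw [e1, e2]
    linear_combination (x - y) ^ 2 * (x - y') ^ 2 * h3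
  exact (Finset.card_le_card hsub).trans (Multiset.toFinset_card_le _)

theorem one_add_sum_le_prod_one_add {ι : Type*} (s : Finset ι) (f : ι → ℝ)
    (hf : ∀ i ∈ s, 0 ≤ f i) : 1 + ∑ i ∈ s, f i ≤ ∏ i ∈ s, (1 + f i) := by
  classical
  induction s using Finset.induction_on with
  | empty => simp
  | insert i s hi ih =>
    rw [Finset.sum_insert hi, Finset.prod_insert hi]
    have h1 := ih fun j hj => hf j (Finset.mem_insert_of_mem hj)
    have h2 := hf i (Finset.mem_insert_self _ _)
    have h3 : 0 ≤ ∑ i ∈ s, f i := Finset.sum_nonneg fun j hj => hf j (Finset.mem_insert_of_mem hj)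
    nlinarith

namespace InterlacingWeights

variable {n : ℝ} {X Y : Finset ℝ} {p a : ℝ → ℝ} (h : InterlacingWeights n X Y p a)
include h

theorem ne {x y : ℝ} (hx : x ∈ X) (hy : y ∈ Y) : x ≠ y := by
  rintro rfl
  have := h.one_le_abs_sub x hx x hy
  norm_num at this

theorem nonempty : X.Nonempty := by
  rw [Finset.nonempty_iff_ne_empty]
  intro h0
  have := h.sum_p
  rw [h0] at this
  simp at this

/-- Otherwise all terms of the vanishing sum `sum_div_eq_zero` have the same sign. -/
theorem exists_gt {y : ℝ} (hy : y ∈ Y) : ∃ x ∈ X, y < x := by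
  by_contra! hcon
  have h1 : 0 < ∑ x ∈ X, p x / (y - x) := by
    refine Finset.sum_pos (fun x hx => div_pos (h.p_pos x hx) ?_) h.nonempty
    exact sub_pos.2 (lt_of_le_of_ne (hcon x hx) (h.ne hx hy))
  rw [h.sum_div_eq_zero y hy] at h1
  exact lt_irrefl _ h1

theorem exists_lt {y : ℝ} (hy : y ∈ Y) : ∃ x ∈ X, x < y := by
  by_contra! hcon
  have h1 : ∑ x ∈ X, p x / (y - x) < 0 := by
    refine Finset.sum_neg (fun x hx => div_neg_of_pos_of_neg (h.p_pos x hx) ?_) h.nonempty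
    exact sub_neg.2 (lt_of_le_of_ne (hcon x hx) (h.ne hx hy).symm)
  rw [h.sum_div_eq_zero y hy] at h1
  exact lt_irrefl _ h1

/-- Subtracting the vanishing sums at y and y' leaves terms p x (y' - y) / ((y - x)(y' - x)), all
positive if no x separates y from y'. -/
theorem exists_between {y y' : ℝ} (hy : y ∈ Y) (hy' : y' ∈ Y) (hlt : y < y') :
    ∃ x ∈ X, y < x ∧ x < y' := by
  by_contra! hcon
  have h1 : 0 < ∑ x ∈ X, (p x / (y - x) - p x / (y' - x)) := by
    refine Finset.sum_pos (fun x hx => ?_) h.nonempty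
    have hne := h.ne hx hy
    have hne' := h.ne hx hy'
    have h2 : p x / (y - x) - p x / (y' - x) = p x * (y' - y) / ((y - x) * (y' - x)) := by
      have := sub_ne_zero.2 hne.symm
      have := sub_ne_zero.2 hne'.symm
      field_simp
      ring
    rw [h2]
    refine div_pos (mul_pos (h.p_pos x hx) (sub_pos.2 hlt)) ?_
    rcases lt_or_gt_of_ne hne with hxy | hxy
    · exact mul_pos (by linarith) (by linarith)
    · have := lt_of_le_of_ne (hcon x hx hxy) hne'.symm
      exact mul_pos_of_neg_of_neg (by linarith) (by linarith)
  rw [Finset.sum_sub_distrib, h.sum_div_eq_zero y hy, h.sum_div_eq_zero y' hy'] at h1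
  norm_num at h1

theorem add_one_le {y y' : ℝ} (hy : y ∈ Y) (hy' : y' ∈ Y) (hlt : y < y') : y + 1 ≤ y' := by
  obtain ⟨x, hx, h1, h2⟩ := h.exists_between hy hy' hlt
  have h3 := h.one_le_abs_sub x hx y hy
  rw [abs_of_pos (by linarith)] at h3
  linarith

theorem exists_next {y : ℝ} (hy : y ∈ Y) :
    ∃ x ∈ X, y + 1 ≤ x ∧ ∀ x' ∈ X, y < x' → x ≤ x' := by
  have hne : (X.filter (y < ·)).Nonempty := by
    obtain ⟨x, hx, hlt⟩ := h.exists_gt hy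
    exact ⟨x, Finset.mem_filter.2 ⟨hx, hlt⟩⟩
  have hmem := Finset.min'_mem _ hne
  obtain ⟨hx, hlt⟩ := Finset.mem_filter.1 hmem
  refine ⟨_, hx, ?_, fun x' hx' hlt' => Finset.min'_le _ _ (Finset.mem_filter.2 ⟨hx', hlt'⟩)⟩
  have h3 := h.one_le_abs_sub _ hx y hy
  rw [abs_of_pos (by linarith)] at h3
  linarith

theorem exists_prev {y : ℝ} (hy : y ∈ Y) :
    ∃ x ∈ X, x ≤ y - 1 ∧ ∀ x' ∈ X, x' < y → x' ≤ x := by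
  have hne : (X.filter (· < y)).Nonempty := by
    obtain ⟨x, hx, hlt⟩ := h.exists_lt hy
    exact ⟨x, Finset.mem_filter.2 ⟨hx, hlt⟩⟩
  have hmem := Finset.max'_mem _ hne
  obtain ⟨hx, hlt⟩ := Finset.mem_filter.1 hmem
  refine ⟨_, hx, ?_, fun x' hx' hlt' => Finset.le_max' _ _ (Finset.mem_filter.2 ⟨hx', hlt'⟩)⟩
  have h3 := h.one_le_abs_sub _ hx y hy
  rw [abs_of_neg (by linarith)] at h3
  linarith

/-- An injection moving each element of `Y` away from the origin by at least one. -/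
theorem exists_outward : ∃ f : ℝ → ℝ, (∀ y ∈ Y, f y ∈ X) ∧ Set.InjOn f Y ∧
    ∀ y ∈ Y, |y| + 1 ≤ |f y| := by
  choose! u hu hu1 hu2 using fun y (hy : y ∈ Y) => h.exists_next hy
  choose! l hl hl1 hl2 using fun y (hy : y ∈ Y) => h.exists_prev hy
  refine ⟨fun y => if 0 ≤ y then u y else l y, ?_, ?_, ?_⟩
  · intro y hy
    dsimp only
    split_ifs
    · exact hu y hy
    · exact hl y hy
  · have key : ∀ y ∈ Y, ∀ y' ∈ Y, y < y' →
        (if 0 ≤ y then u y else l y) ≠ if 0 ≤ y' then u y' else l y' := by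
      intro y hy y' hy' hlt
      apply _root_.ne_of_lt
      obtain ⟨x, hx, h1, h2⟩ := h.exists_between hy hy' hlt
      have e1 := hu2 y hy x hx h1
      have e2 := hl2 y' hy' x hx h2
      have e3 := hu1 y hy
      have e4 := hu1 y' hy'
      have e5 := hl1 y hy
      have e6 := hl1 y' hy'
      split_ifs <;> linarith
    intro y hy y' hy' heq
    by_contra hne
    rcases lt_or_gt_of_ne hne with hlt | hlt
    · exact key y hy y' hy' hlt heq
    · exact key y' hy' y hy hlt heq.symm
  · intro y hy
    dsimp only
    split_ifs with h0
    · rw [abs_of_nonneg h0]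
      exact (hu1 y hy).trans (le_abs_self _)
    · rw [abs_of_neg (not_le.1 h0)]
      have := hl1 y hy
      have := neg_le_abs (l y)
      linarith

theorem card_lt : Y.card + 1 ≤ X.card := by
  rcases Y.eq_empty_or_nonempty with hY | hY
  · rw [hY, Finset.card_empty, zero_add]
    exact h.nonempty.card_pos
  · choose! u hu hu1 hu2 using fun y (hy : y ∈ Y) => h.exists_next hy
    have hmin := Finset.min'_mem Y hY
    obtain ⟨x₀, hx₀, hlt₀⟩ := h.exists_lt hmin
    have hmaps : Y.image u ⊆ X.erase x₀ := by
      intro x hx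
      obtain ⟨y, hy, rfl⟩ := Finset.mem_image.1 hx
      refine Finset.mem_erase.2 ⟨?_, hu y hy⟩
      have := Finset.min'_le Y y hy
      have := hu1 y hy
      intro heq
      linarith
    have key : ∀ y ∈ Y, ∀ y' ∈ Y, y < y' → u y ≠ u y' := by
      intro y hy y' hy' hlt
      apply _root_.ne_of_lt
      obtain ⟨x, hx, h1, h2⟩ := h.exists_between hy hy' hlt
      have e1 := hu2 y hy x hx h1
      have e4 := hu1 y' hy'
      linarith
    have hinj : Set.InjOn u Y := by
      intro y hy y' hy' heq
      by_contra hne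
      rcases lt_or_gt_of_ne hne with hlt | hlt
      · exact key y hy y' hy' hlt heq
      · exact key y' hy' y hy hlt heq.symm
    have h1 := Finset.card_le_card hmaps
    rw [Finset.card_image_of_injOn hinj, Finset.card_erase_of_mem hx₀] at h1
    have := Finset.card_pos.2 ⟨x₀, hx₀⟩
    omega

open Polynomial in
-- The right side is the numerator of z - ∑ a y / (z - y), monic of degree |Y| + 1 and vanishing on
-- X, while X has at least |Y| + 1 elements.
theorem prod_identity : X.card = Y.card + 1 ∧
    ∏ x ∈ X, (Polynomial.X - C x) = Polynomial.X * ∏ y ∈ Y, (Polynomial.X - C y)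
      - ∑ y ∈ Y, C (a y) * ∏ y' ∈ Y.erase y, (Polynomial.X - C y') := by
  set N : ℝ[X] := ∏ y ∈ Y, (Polynomial.X - C y) with hN
  set R : ℝ[X] := ∑ y ∈ Y, C (a y) * ∏ y' ∈ Y.erase y, (Polynomial.X - C y') with hR
  have hNm : N.Monic := monic_prod_of_monic _ _ fun y _ => monic_X_sub_C y
  have hNdeg : N.degree = Y.card := by
    rw [hN, degree_prod]
    simp
  have hXN : (Polynomial.X * N).degree = ((Y.card + 1 : ℕ) : WithBot ℕ) := by
    rw [degree_mul, degree_X, hNdeg]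
    push_cast
    ring
  have hRdeg : R.degree < (Y.card + 1 : ℕ) := by
    refine lt_of_le_of_lt (degree_sum_le _ _) ?_
    rw [Finset.sup_lt_iff (WithBot.bot_lt_coe _)]
    intro y hy
    rw [degree_C_mul (h.a_pos y hy).ne', degree_prod]
    simp only [degree_X_sub_C, Finset.sum_const, Finset.card_erase_of_mem hy, nsmul_eq_mul,
      mul_one]
    exact_mod_cast (by omega : Y.card - 1 < Y.card + 1)
  have hmonic : (Polynomial.X * N - R).Monic := by
    refine (monic_X.mul hNm).sub_of_left ?_
    rw [hXN]
    exact hRdeg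
  have hdeg : (Polynomial.X * N - R).degree = ((Y.card + 1 : ℕ) : WithBot ℕ) := by
    rw [degree_sub_eq_left_of_degree_lt (by rw [hXN]; exact hRdeg), hXN]
  have hroot : ∀ x ∈ X, (Polynomial.X * N - R).eval x = 0 := by
    intro x hx
    have hRx : R.eval x = N.eval x * ∑ y ∈ Y, a y / (x - y) := by
      rw [hR, eval_finsetSum, Finset.mul_sum]
      refine Finset.sum_congr rfl fun y hy => ?_
      have hxy : x - y ≠ 0 := sub_ne_zero.2 (h.ne hx hy)
      rw [hN, ← Finset.mul_prod_erase Y _ hy]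
      simp only [eval_mul, eval_C, eval_sub, eval_X]
      field_simp
    rw [eval_sub, eval_mul, eval_X, hRx, ← h.eq_sum_div x hx]
    ring
  have hcard : X.card ≤ Y.card + 1 := by
    have h1 : X ⊆ (Polynomial.X * N - R).roots.toFinset := by
      intro x hx
      rw [Multiset.mem_toFinset, mem_roots hmonic.ne_zero]
      exact hroot x hx
    have h2 := (Finset.card_le_card h1).trans (Multiset.toFinset_card_le _)
    exact h2.trans ((card_roots' _).trans (natDegree_le_of_degree_le hdeg.le))
  have hceq : X.card = Y.card + 1 := le_antisymm hcard h.card_lt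
  refine ⟨hceq, ?_⟩
  have hDdeg : (∏ x ∈ X, (Polynomial.X - C x)).degree = ((Y.card + 1 : ℕ) : WithBot ℕ) := by
    rw [degree_prod, ← hceq]
    simp
  have hDm : (∏ x ∈ X, (Polynomial.X - C x)).Monic :=
    monic_prod_of_monic _ _ fun y _ => monic_X_sub_C y
  refine eq_of_degree_sub_lt_of_eval_finset_eq X ?_ fun x hx => ?_
  · rw [hceq, ← hDdeg]
    exact degree_sub_lt_left (hDdeg.trans hdeg.symm) hDm.ne_zero
      (hDm.leadingCoeff.trans hmonic.leadingCoeff.symm)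
  · rw [hroot x hx, eval_prod]
    exact Finset.prod_eq_zero hx (by simp)

/-- Evaluate `prod_identity` at iT and take squared moduli. -/
theorem prod_sq_le {T : ℝ} (hT : 0 < T) :
    ∏ x ∈ X, (T ^ 2 + x ^ 2) ≤ (T + n / T) ^ 2 * ∏ y ∈ Y, (T ^ 2 + y ^ 2) := by
  have hid := congrArg (Polynomial.aeval (Complex.I * T)) h.prod_identity.2
  simp only [map_prod, map_sub, map_mul, map_sum, Polynomial.aeval_X, Polynomial.aeval_C] at hid
  have hnorm : ∀ x : ℝ, ‖Complex.I * T - algebraMap ℝ ℂ x‖ ^ 2 = T ^ 2 + x ^ 2 := by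
    intro x
    rw [← Complex.normSq_eq_norm_sq, Complex.normSq_apply]
    simp
    ring
  have hge : ∀ x : ℝ, T ≤ ‖Complex.I * T - algebraMap ℝ ℂ x‖ := by
    intro x
    refine le_of_sq_le_sq ?_ (norm_nonneg _)
    rw [hnorm]
    nlinarith [sq_nonneg x]
  have h1 : ∏ x ∈ X, ‖Complex.I * T - algebraMap ℝ ℂ x‖
      ≤ (T + n / T) * ∏ y ∈ Y, ‖Complex.I * T - algebraMap ℝ ℂ y‖ := by
    rw [← norm_prod, hid]
    refine (norm_sub_le _ _).trans ?_
    rw [add_mul]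
    refine add_le_add ?_ ?_
    · rw [norm_mul, norm_prod]
      simp [abs_of_pos hT]
    · refine (norm_sum_le _ _).trans ?_
      rw [← h.sum_a, Finset.sum_div, Finset.sum_mul]
      refine Finset.sum_le_sum fun y hy => ?_
      rw [norm_mul, norm_prod, ← Finset.mul_prod_erase Y _ hy]
      have ha := h.a_pos y hy
      have h2 : ‖algebraMap ℝ ℂ (a y)‖ = a y := by simp [abs_of_pos ha]
      rw [h2]
      have h3 : 0 ≤ ∏ y' ∈ Y.erase y, ‖Complex.I * T - algebraMap ℝ ℂ y'‖ :=
        Finset.prod_nonneg fun _ _ => norm_nonneg _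
      rw [← mul_assoc]
      refine mul_le_mul_of_nonneg_right ?_ h3
      rw [div_mul_eq_mul_div, le_div_iff₀ hT]
      exact mul_le_mul_of_nonneg_left (hge y) ha.le
  have h4 := pow_le_pow_left₀ (Finset.prod_nonneg fun _ _ => norm_nonneg _) h1 2
  rw [mul_pow, ← Finset.prod_pow, ← Finset.prod_pow] at h4
  simpa only [hnorm] using h4

/-- Comparing coefficients in `prod_identity` suggests ∑ x² - ∑ y² = 2n, while moving outward raises
y² by at least 2|y| + 1. Evaluating `prod_sq_le` at one large T replaces the coefficient comparison,
at the price of the constant 6. -/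
theorem sum_abs_le (hn : 0 ≤ n) : ∑ y ∈ Y, (2 * |y| + 1) ≤ 6 * n := by
  obtain ⟨f, hfX, hfinj, hf⟩ := h.exists_outward
  set T : ℝ := 1 + n + ∑ y ∈ Y, |y| with hTdef
  have hsum : 0 ≤ ∑ y ∈ Y, |y| := Finset.sum_nonneg fun _ _ => abs_nonneg _
  have hT : 0 < T := by positivity
  have hTn : n ≤ T ^ 2 := by nlinarith
  have hTy : ∀ y ∈ Y, y ^ 2 ≤ T ^ 2 := by
    intro y hy
    have := Finset.single_le_sum (f := fun y => |y|) (fun _ _ => abs_nonneg _) hy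
    rw [← sq_abs]
    refine pow_le_pow_left₀ (abs_nonneg _) ?_ 2
    linarith
  have hprodY : 0 < ∏ y ∈ Y, (T ^ 2 + y ^ 2) := Finset.prod_pos fun y _ => by positivity
  have hsub : Y.image f ⊆ X := Finset.image_subset_iff.2 hfX
  have hlow : T ^ 2 * ∏ y ∈ Y, (T ^ 2 + (f y) ^ 2) ≤ ∏ x ∈ X, (T ^ 2 + x ^ 2) := by
    rw [← Finset.prod_sdiff hsub, Finset.prod_image hfinj]
    refine mul_le_mul_of_nonneg_right ?_ (Finset.prod_nonneg fun y _ => by positivity)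
    -- One element of X is left over, and it accounts for the factor T².
    have hc : (X \ Y.image f).card = 1 := by
      rw [Finset.card_sdiff_of_subset hsub, Finset.card_image_of_injOn hfinj, h.prod_identity.1]
      omega
    obtain ⟨x, hx⟩ := Finset.card_eq_one.1 hc
    rw [hx, Finset.prod_singleton]
    nlinarith [sq_nonneg x]
  have hfac : (∏ y ∈ Y, (1 + (2 * |y| + 1) / (T ^ 2 + y ^ 2))) * ∏ y ∈ Y, (T ^ 2 + y ^ 2)
      ≤ ∏ y ∈ Y, (T ^ 2 + (f y) ^ 2) := by
    rw [← Finset.prod_mul_distrib]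
    refine Finset.prod_le_prod (fun y _ => by positivity) fun y hy => ?_
    have h1 : 0 < T ^ 2 + y ^ 2 := by positivity
    rw [add_mul, div_mul_cancel₀ _ h1.ne', one_mul]
    have h2 := pow_le_pow_left₀ (by positivity) (hf y hy) 2
    rw [sq_abs] at h2
    nlinarith [sq_abs y]
  have h1 : 1 + ∑ y ∈ Y, (2 * |y| + 1) / (T ^ 2 + y ^ 2)
      ≤ ∏ y ∈ Y, (1 + (2 * |y| + 1) / (T ^ 2 + y ^ 2)) :=
    one_add_sum_le_prod_one_add _ _ fun y _ => by positivity
  have h2 : T ^ 2 * (1 + ∑ y ∈ Y, (2 * |y| + 1) / (T ^ 2 + y ^ 2)) ≤ (T + n / T) ^ 2 := by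
    refine le_of_mul_le_mul_right ?_ hprodY
    calc _ ≤ T ^ 2 * ((∏ y ∈ Y, (1 + (2 * |y| + 1) / (T ^ 2 + y ^ 2))) *
          ∏ y ∈ Y, (T ^ 2 + y ^ 2)) := by
          rw [mul_assoc]
          gcongr
      _ ≤ T ^ 2 * ∏ y ∈ Y, (T ^ 2 + (f y) ^ 2) := by gcongr
      _ ≤ _ := hlow.trans (h.prod_sq_le hT)
  have h3 : (∑ y ∈ Y, (2 * |y| + 1)) / (2 * T ^ 2)
      ≤ ∑ y ∈ Y, (2 * |y| + 1) / (T ^ 2 + y ^ 2) := by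
    rw [Finset.sum_div]
    refine Finset.sum_le_sum fun y hy => ?_
    have := hTy y hy
    gcongr
    linarith
  have h4 : (T + n / T) ^ 2 = T ^ 2 + 2 * n + n * (n / T ^ 2) := by
    field_simp
    ring
  have h5 : n / T ^ 2 ≤ 1 := by
    rw [div_le_one (by positivity)]
    exact hTn
  have h6 : T ^ 2 * ((∑ y ∈ Y, (2 * |y| + 1)) / (2 * T ^ 2)) = (∑ y ∈ Y, (2 * |y| + 1)) / 2 := by
    field_simp
  have h7 := mul_le_mul_of_nonneg_left h3 (sq_nonneg T)
  rw [h6] at h7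
  nlinarith

/-- At most 3r elements have |y| ≥ r, by `sum_abs_le`. The others are spaced by at least 1 in (-r,
r), hence have distinct integer parts. -/
theorem card_le {r : ℝ} (hr : 1 ≤ r) (hn : n = r ^ 2) : (Y.card : ℝ) + 1 ≤ 9 * r := by
  have hsum := h.sum_abs_le (by rw [hn]; positivity)
  set A := Y.filter (fun y => r ≤ |y|) with hA
  set B := Y.filter (fun y => ¬ r ≤ |y|) with hB
  have hcard : A.card + B.card = Y.card := Finset.card_filter_add_card_filter_not _
  have hAcard : (A.card : ℝ) ≤ 3 * r := by
    have h1 : (A.card : ℝ) * (2 * r) ≤ ∑ y ∈ A, (2 * |y| + 1) := by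
      rw [← nsmul_eq_mul]
      refine Finset.card_nsmul_le_sum _ _ _ fun y hy => ?_
      have := (Finset.mem_filter.1 hy).2
      linarith
    have h2 : ∑ y ∈ A, (2 * |y| + 1) ≤ ∑ y ∈ Y, (2 * |y| + 1) :=
      Finset.sum_le_sum_of_subset_of_nonneg (Finset.filter_subset _ _)
        fun y _ _ => by positivity
    rw [hn] at hsum
    nlinarith
  have hBcard : (B.card : ℝ) ≤ 2 * r + 3 := by
    have hinj : Set.InjOn (fun y : ℝ => ⌊y⌋) B := by
      intro y hy y' hy' heq
      have hyY := (Finset.mem_filter.1 hy).1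
      have hyY' := (Finset.mem_filter.1 hy').1
      simp only at heq
      have e1 := Int.floor_le y
      have e2 := Int.lt_floor_add_one y
      have e3 := Int.floor_le y'
      have e4 := Int.lt_floor_add_one y'
      rw [heq] at e1 e2
      by_contra hne
      rcases lt_or_gt_of_ne hne with hlt | hlt
      · have := h.add_one_le hyY hyY' hlt
        linarith
      · have := h.add_one_le hyY' hyY hlt
        linarith
    have hmaps : B.image (fun y : ℝ => ⌊y⌋) ⊆ Finset.Icc ⌊-r⌋ ⌊r⌋ := by
      intro m hm
      obtain ⟨y, hy, rfl⟩ := Finset.mem_image.1 hm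
      have h1 := abs_lt.1 (not_le.1 (Finset.mem_filter.1 hy).2)
      exact Finset.mem_Icc.2 ⟨Int.floor_mono h1.1.le, Int.floor_mono h1.2.le⟩
    have h1 := Finset.card_le_card hmaps
    rw [Finset.card_image_of_injOn hinj, Int.card_Icc] at h1
    have h2 : ⌊-r⌋ ≤ ⌊r⌋ := Int.floor_mono (by linarith)
    have h3 : (B.card : ℤ) ≤ ⌊r⌋ + 1 - ⌊-r⌋ := by omega
    have h4 : (B.card : ℝ) ≤ ⌊r⌋ + 1 - ⌊-r⌋ := by exact_mod_cast h3
    have e1 := Int.floor_le r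
    have e2 := Int.lt_floor_add_one (-r)
    linarith
  have : (Y.card : ℝ) = A.card + B.card := by exact_mod_cast hcard.symm
  linarith

end InterlacingWeights

/-! ### Counting pairs whose weight lies in a finite set. -/

/-- A bipartite relation with `r x y` such that any two rows share at most `t` columns has few
edges. -/
theorem card_filter_product_sq_le {ι κ : Type*} [DecidableEq ι] [DecidableEq κ] (X : Finset ι)
    (Y : Finset κ) (r : ι → κ → Prop) [∀ x y, Decidable (r x y)] (t : ℕ)
    (ht : ∀ y ∈ Y, ∀ y' ∈ Y, y ≠ y' → (X.filter fun x => r x y ∧ r x y').card ≤ t) :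
    ((X ×ˢ Y).filter fun q => r q.1 q.2).card ^ 2
      ≤ X.card * (X.card * Y.card + Y.card ^ 2 * t) := by
  have hE : ((X ×ˢ Y).filter fun q => r q.1 q.2).card
      = ∑ x ∈ X, ∑ y ∈ Y, if r x y then 1 else 0 := by
    rw [Finset.card_filter, Finset.sum_product]
  rw [hE]
  -- Cauchy–Schwarz over the columns; the sum of squared degrees then counts common neighbours of
  -- pairs of rows.
  refine sq_sum_le_card_mul_sum_sq.trans (Nat.mul_le_mul_left _ ?_)
  have h1 : ∑ x ∈ X, (∑ y ∈ Y, if r x y then 1 else 0) ^ 2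
      = ∑ y ∈ Y, ∑ y' ∈ Y, (X.filter fun x => r x y ∧ r x y').card := by
    simp only [sq, Finset.sum_mul_sum]
    rw [Finset.sum_comm]
    refine Finset.sum_congr rfl fun y _ => ?_
    rw [Finset.sum_comm]
    refine Finset.sum_congr rfl fun y' _ => ?_
    rw [Finset.card_filter]
    refine Finset.sum_congr rfl fun x _ => ?_
    by_cases h1 : r x y <;> by_cases h2 : r x y' <;> simp [h1, h2]
  rw [h1]
  have h2 : ∀ y ∈ Y, ∑ y' ∈ Y, (X.filter fun x => r x y ∧ r x y').card
      ≤ X.card + Y.card * t := by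
    intro y hy
    rw [← Finset.add_sum_erase Y _ hy]
    refine add_le_add (Finset.card_filter_le _ _) ?_
    calc _ ≤ ∑ y' ∈ Y.erase y, t := Finset.sum_le_sum fun y' hy' =>
          ht y hy y' (Finset.mem_of_mem_erase hy') (Finset.ne_of_mem_erase hy').symm
      _ ≤ Y.card * t := by
          rw [Finset.sum_const, smul_eq_mul]
          exact Nat.mul_le_mul_right _ (Finset.card_le_card (Finset.erase_subset _ _))
  refine (Finset.sum_le_sum h2).trans (le_of_eq ?_)
  rw [Finset.sum_const, smul_eq_mul]
  ring

namespace InterlacingWeights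

variable {n : ℝ} {X Y : Finset ℝ} {p a : ℝ → ℝ} (h : InterlacingWeights n X Y p a)
include h

theorem sum_weights : ∑ x ∈ X, ∑ y ∈ Y, a y * (p x * (1 - 1 / (x - y) ^ 2)) = n - Y.card := by
  rw [Finset.sum_comm]
  have h1 : ∀ y ∈ Y, ∑ x ∈ X, a y * (p x * (1 - 1 / (x - y) ^ 2)) = a y - 1 := by
    intro y hy
    have ha := (h.a_pos y hy).ne'
    have h2 : ∀ x ∈ X, p x * (1 - 1 / (x - y) ^ 2) = p x - p x / (y - x) ^ 2 := by
      intro x _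
      rw [← neg_sub y x, neg_sq]
      ring
    rw [← Finset.mul_sum, Finset.sum_congr rfl h2, Finset.sum_sub_distrib, h.sum_p,
      h.sum_div_sq y hy]
    field_simp
  rw [Finset.sum_congr rfl h1, Finset.sum_sub_distrib, h.sum_a]
  simp

/-- The pair of weights takes at most |S|² values. For fixed values, eliminating p x leaves an
equation with at most four solutions. -/
theorem card_common_le {S : Finset ℝ} {y y' : ℝ} (hy : y ∈ Y) (hy' : y' ∈ Y) (hne : y ≠ y')
    {s : Finset ℝ} (hsX : s ⊆ X)
    (hs : ∀ x ∈ s, (a y * (p x * (1 - 1 / (x - y) ^ 2)) ∈ S ∧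
      0 < a y * (p x * (1 - 1 / (x - y) ^ 2))) ∧
      (a y' * (p x * (1 - 1 / (x - y') ^ 2)) ∈ S ∧
      0 < a y' * (p x * (1 - 1 / (x - y') ^ 2)))) :
    s.card ≤ 4 * S.card ^ 2 := by
  let f : ℝ → ℝ × ℝ := fun x =>
    (a y * (p x * (1 - 1 / (x - y) ^ 2)), a y' * (p x * (1 - 1 / (x - y') ^ 2)))
  have himg : s.image f ⊆ S ×ˢ S := by
    intro q hq
    obtain ⟨x, hx, rfl⟩ := Finset.mem_image.1 hq
    exact Finset.mem_product.2 ⟨(hs x hx).1.1, (hs x hx).2.1⟩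
  have h1 : s.card ≤ 4 * (s.image f).card := by
    refine Finset.card_le_mul_card_image s 4 fun q hq => ?_
    obtain ⟨x₀, hx₀, hq⟩ := Finset.mem_image.1 hq
    have hu : 0 < q.1 := hq ▸ (hs x₀ hx₀).1.2
    have hv : 0 < q.2 := hq ▸ (hs x₀ hx₀).2.2
    refine card_le_four_of_proportional (y := y) (y' := y') (A := q.2 * a y) (B := q.1 * a y') hne
      (mul_pos hv (h.a_pos y hy)).ne' fun x hx => ?_
    obtain ⟨hxs, hfx⟩ := Finset.mem_filter.1 hx
    have hxX := hsX hxs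
    refine ⟨h.ne hxX hy, h.ne hxX hy', ?_⟩
    have e1 : a y * (p x * (1 - 1 / (x - y) ^ 2)) = q.1 := congrArg Prod.fst hfx
    have e2 : a y' * (p x * (1 - 1 / (x - y') ^ 2)) = q.2 := congrArg Prod.snd hfx
    have hp := (h.p_pos x hxX).ne'
    apply mul_left_cancel₀ hp
    linear_combination q.2 * e1 - q.1 * e2
  refine h1.trans (Nat.mul_le_mul_left _ ?_)
  refine (Finset.card_le_card himg).trans (le_of_eq ?_)
  rw [Finset.card_product, sq]

end InterlacingWeights

/-- For large `n`, some weight `a y * p x * (1 - 1 / (x - y)²)` is bounded below and avoids a given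
finite set. -/
theorem exists_weight_avoiding (S : Finset ℝ) : ∃ N : ℕ, ∀ n : ℝ, N < n →
    ∀ (X Y : Finset ℝ) (p a : ℝ → ℝ), InterlacingWeights n X Y p a →
      ∃ x ∈ X, ∃ y ∈ Y, 1 < |x - y| ∧ 1 / 324 ≤ a y * (p x * (1 - 1 / (x - y) ^ 2)) ∧
        a y * (p x * (1 - 1 / (x - y) ^ 2)) ∉ S := by
  classical
  obtain ⟨M, hM1, hM⟩ : ∃ M : ℝ, 1 ≤ M ∧ ∀ s ∈ S, s ≤ M := by
    refine ⟨1 + ∑ s ∈ S, |s|, ?_, fun s hs => ?_⟩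
    · have : 0 ≤ ∑ s ∈ S, |s| := Finset.sum_nonneg fun _ _ => abs_nonneg _
      linarith
    · have := Finset.single_le_sum (f := fun s : ℝ => |s|) (fun _ _ => abs_nonneg _) hs
      have := le_abs_self s
      linarith
  set t : ℕ := 4 * S.card ^ 2 with ht
  -- 1296 = 36² makes 9√n at most n/4, and 2916 = 4 · 729 is the constant in the final comparison.
  obtain ⟨N, hN⟩ := exists_nat_gt (1296 + (2916 * M ^ 2 * (1 + t)) ^ 2)
  refine ⟨N, fun n hn X Y p a h => ?_⟩
  by_contra! hcon
  set w : ℝ → ℝ → ℝ := fun x y => a y * (p x * (1 - 1 / (x - y) ^ 2)) with hw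
  have hnpos : 1296 + (2916 * M ^ 2 * (1 + t)) ^ 2 < n := hN.trans hn
  obtain ⟨r, hr0, hrn⟩ : ∃ r : ℝ, 0 ≤ r ∧ n = r ^ 2 :=
    ⟨√n, Real.sqrt_nonneg n, (Real.sq_sqrt (by nlinarith [sq_nonneg (2916 * M ^ 2 * (1 + t))])).symm⟩
  have hr36 : 36 < r := by
    by_contra! hle
    nlinarith [sq_nonneg (2916 * M ^ 2 * (1 + t))]
  have hrt : 2916 * M ^ 2 * (1 + t) < r := by
    refine lt_of_pow_lt_pow_left₀ 2 hr0 ?_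
    rw [← hrn]
    linarith
  have hcard := h.card_le (r := r) (by linarith) hrn
  have hXcard : (X.card : ℝ) = Y.card + 1 := by exact_mod_cast h.prod_identity.1
  let R : ℝ → ℝ → Prop := fun x y => w x y ∈ S ∧ 0 < w x y
  set E := (X ×ˢ Y).filter fun q => R q.1 q.2 with hE
  have hE1 : (E.card : ℝ) ^ 2 ≤ X.card * (X.card * Y.card + Y.card ^ 2 * t) := by
    have := card_filter_product_sq_le X Y R t fun y hy y' hy' hne =>
      h.card_common_le (S := S) hy hy' hne (Finset.filter_subset _ _)
        fun x hx => (Finset.mem_filter.1 hx).2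
    exact_mod_cast this
  have hE2 : n - Y.card ≤ 1 / 324 * (X.card * Y.card) + M * E.card := by
    rw [← h.sum_weights, ← Finset.sum_product']
    -- Under the contrary assumption a weight is either below 1/324 or in S, hence at most M.
    have hpt : ∀ q ∈ X ×ˢ Y, a q.2 * (p q.1 * (1 - 1 / (q.1 - q.2) ^ 2))
        ≤ 1 / 324 + M * if R q.1 q.2 then 1 else 0 := by
      rintro ⟨x, y⟩ hq
      obtain ⟨hx, hy⟩ := Finset.mem_product.1 hq
      change w x y ≤ 1 / 324 + M * if R x y then 1 else 0
      split_ifs with hR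
      · have := hM _ hR.1
        linarith
      · rw [mul_zero, add_zero]
        by_contra! hlt
        have hwpos : 0 < w x y := by linarith
        -- Pairs with |x - y| = 1 have weight zero and cannot occur here.
        refine hR ⟨hcon x hx y hy ?_ hlt.le, hwpos⟩
        refine lt_of_le_of_ne (h.one_le_abs_sub x hx y hy) fun h1 => ?_
        have : (x - y) ^ 2 = 1 := by rw [← sq_abs, ← h1, one_pow]
        simp only [hw, this] at hwpos
        norm_num at hwpos
    refine (Finset.sum_le_sum hpt).trans (le_of_eq ?_)
    rw [Finset.sum_add_distrib, ← Finset.mul_sum, Finset.sum_const, Finset.card_product,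
      Finset.sum_ite, Finset.sum_const_zero, add_zero, Finset.sum_const]
    simp only [nsmul_eq_mul, mul_one]
    push_cast
    ring
  set c : ℝ := ((Y.card : ℕ) : ℝ) with hc
  have hc0 : 0 ≤ c := Nat.cast_nonneg _
  rw [hXcard] at hE1 hE2
  have ht0 : (0 : ℝ) ≤ t := Nat.cast_nonneg _
  have hk2 : (c + 1) ^ 2 ≤ 81 * r ^ 2 := by
    calc (c + 1) ^ 2 ≤ (9 * r) ^ 2 := pow_le_pow_left₀ (by linarith) hcard 2
      _ = _ := by ring
  have hk3 : (c + 1) ^ 3 ≤ 729 * r ^ 3 := by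
    calc (c + 1) ^ 3 ≤ (9 * r) ^ 3 := pow_le_pow_left₀ (by linarith) hcard 3
      _ = _ := by ring
  have hE3 : (E.card : ℝ) ^ 2 ≤ 729 * r ^ 3 * (1 + t) := by
    refine hE1.trans (le_trans ?_ (mul_le_mul_of_nonneg_right hk3 (by linarith)))
    have h1 : (c + 1) * c + c ^ 2 * t ≤ (c + 1) ^ 2 * (1 + t) := by nlinarith
    calc _ ≤ (c + 1) * ((c + 1) ^ 2 * (1 + t)) :=
          mul_le_mul_of_nonneg_left h1 (by linarith)
      _ = _ := by ring
  -- Both |Y| and (c + 1) c / 324 are at most r²/4, leaving half of n = r² to the pairs with weight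
  -- in S.
  have hE4 : r ^ 2 / 2 ≤ M * E.card := by
    rw [hrn] at hE2
    nlinarith
  have hE5 : (r ^ 2 / 2) ^ 2 ≤ M ^ 2 * (729 * r ^ 3 * (1 + t)) := by
    calc (r ^ 2 / 2) ^ 2 ≤ (M * E.card) ^ 2 := pow_le_pow_left₀ (by positivity) hE4 2
      _ = M ^ 2 * (E.card : ℝ) ^ 2 := by ring
      _ ≤ _ := mul_le_mul_of_nonneg_left hE3 (sq_nonneg M)
  have hr3 : 0 < r ^ 3 := by positivity
  nlinarith [mul_lt_mul_of_pos_left hrt hr3]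

theorem isIrreducible_comp_mulEquiv {G H : Type*} [Group G] [Group H] (e : H ≃* G) {V : Type*}
    [AddCommGroup V] [Module ℂ V] {ρ : Representation ℂ G V} (hρ : ρ.IsIrreducible) :
    Representation.IsIrreducible (ρ.comp e.toMonoidHom : Representation ℂ H V) := by
  rw [isIrreducible_iff_invariant] at hρ ⊢
  refine ⟨hρ.1, fun U hU => hρ.2 U fun g v hv => ?_⟩
  have := hU (e.symm g) v hv
  simpa using this

/-- For every finite set `S` of reals there are `N` and `δ > 0` such that for all `n > N`, every
irreducible character `φ` of the symmetric group on `n` letters admits an irreducible character `ψ`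
of the same group for which `ψ(1)/φ(1)` is a real number lying in `[δ, ∞) \ S`. -/
theorem theorem2p1 (S : Set ℝ) (hS : S.Finite) :
    ∃ (N : ℕ) (δ : ℝ), 0 < δ ∧
      ∀ n : ℕ, N < n →
        ∀ φ : Equiv.Perm (Fin n) → ℂ, IsIrreducibleCharacter φ →
          ∃ ψ : Equiv.Perm (Fin n) → ℂ, IsIrreducibleCharacter ψ ∧
            ∃ r : ℝ, r ∈ Set.Ici δ \ S ∧ ψ 1 / φ 1 = (r : ℂ) := by
  obtain ⟨N, hN⟩ := exists_weight_avoiding hS.toFinset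
  refine ⟨N, 1 / 324, by norm_num, ?_⟩
  rintro n hn φ ⟨V, _, _, ρ, _, hρ, rfl⟩
  obtain ⟨m, rfl⟩ := Nat.exists_eq_succ_of_ne_zero (Nat.ne_zero_of_lt hn)
  -- One letter is singled out as `none`, so that `Fintype.card α + 1` is the number of letters.
  let e : Equiv.Perm (Fin (m + 1)) ≃* Equiv.Perm (Option (Fin m)) :=
    (finSuccEquiv m).permCongrHom
  obtain ⟨X, Y, p, a, hw, hXY⟩ :=
    exists_interlacingWeights (isIrreducible_comp_mulEquiv e.symm hρ)
  obtain ⟨x, hx, y, hy, hxy, hr, hrS⟩ :=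
    hN _ (by rw [Fintype.card_fin]; exact_mod_cast hn) X Y p a hw
  obtain ⟨V', _, _, _, ρ', hρ', hdim⟩ := hXY x hx y hy hxy
  refine ⟨_, ⟨V', _, _, _, inferInstance, isIrreducible_comp_mulEquiv e hρ', rfl⟩, _,
    ⟨hr, fun h => hrS (hS.mem_toFinset.2 h)⟩, ?_⟩
  have := (isIrreducible_iff_invariant.1 hρ).1
  have h0 : (Module.finrank ℂ V : ℂ) ≠ 0 := by exact_mod_cast Module.finrank_pos.ne'
  rw [Representation.char_one, Representation.char_one, div_eq_iff h0]
  exact_mod_cast congrArg ((↑) : ℝ → ℂ) hdim
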